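/- Consider an open Jackson network with $d$ stations, arrival rates $\lambda_i\ge 0$, service rates $\mu_i>0$, and a sub-stochastic routing matrix $P=(P_{ij})$, with $P_{i0}=1-\sum_jP_{ij}$, normalized so that $\sum_i(\lambda_i+\mu_i)=1$. Assume that every station receives jobs from outside, directly or via other stations; that from every station jobs can leave the system, directly or via other stations; and that the network is stable, i.e. the chain $Q$ below has a stationary distribution. Let $Q=(Q(k))_{k\ge0}$ be the embedded chain on $\mathbb Z_+^d$: with probability $\lambda_i$ a job arrives at station $i$; with probability $\mu_iP_{ij}$ (resp. $\mu_iP_{i0}$) a service occurs at station $i$ and, if station $i$ is non-empty, a job moves from $i$ to $j$ (resp. leaves the system), while if station $i$ is empty the state does not change. Let $\rho_i=[\lambda^T(I-P)^{-1}]_i/\mu_i$ be the traffic intensities, $\rho_*=\max_i\rho_i$, and let $\beta=\#\{i:\rho_i=\rho_*\}$ be the number of bottleneck stations in the whole network. Let $v\in\{0,1\}^d$ be non-zero, $V(x)=v^Tx$, $\rho_*^V=\max\{\rho_i:v_i=1\}$, and for a fixed $x\in\mathbb Z_+^d$ let $p_n^V(x)=\mathbb P_x(T_n^V\le T_{\{0\}})$,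 where $T_n^V=\inf\{k\ge1:V(Q(k))\ge n\}$ and $T_{\{0\}}=\inf\{k\ge1:Q(k)=0\}$. Fix an integer $r>1$ and $\Delta\in(0,1]$, and put $\bar W_V(y)=\sum_iy_i\log\rho_i-\log\rho_*^V$ and $U(y)=\Delta\,\bar W_V(y)/\log r$. Let $C_0^n=\{z\in\mathbb Z_+^d:V(z)\ge n\}$, $C_j^n=C_0^n\cup\{z\in\mathbb Z_+^d:U(z/n)\le j\Delta/n\}$ for $j\ge1$, and $l_n(x)=\min\{j\ge0:x\in C_j^n\}$. Run the splitting algorithm: start with one particle at $x$, of level $l_n(x)$; a particle of level $j\ge1$ evolves as $Q$, independently of all the others given its starting point, until it hits $0$ (at a positive time), and dies, or reaches $C_{j-1}^n$ (possibly immediately), where it is replaced by $r$ particles of level $j-1$ at the point reached. Let $N_n(x)$ be the number of particles of level $0$ (those that survive up to $C_0^n$) and let $R_n(x)=r^{-l_n(x)}N_n(x)$ be the splitting estimator of $p_n^V(x)$. Then, as $n\to\infty$, $$\mathbb E\left[R_n(x)^2\right]=p_n^V(x)^2\,O\left(n^{\beta}\right),$$ i.e. for every such network and all fixed $v,r,\Delta,x$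 there are $c,n_0<\infty$ such that $\mathbb E[R_n(x)^2]\le c\,n^{\beta}\,p_n^V(x)^2$ for all $n\ge n_0$. -/

import Mathlib

/-- The data of a Jackson network with `d` stations: arrival rates `lam`, service rates `mu` and a
sub-stochastic routing matrix `P`, with time scaled so that the total rate is one. -/
structure JacksonNetwork (d : ℕ) where
  lam : Fin d → ℝ
  mu : Fin d → ℝ
  P : Matrix (Fin d) (Fin d) ℝ
  lam_nonneg : ∀ i, 0 ≤ lam i
  mu_pos : ∀ i, 0 < mu i
  P_nonneg : ∀ i j, 0 ≤ P i j
  P_row_le : ∀ i, ∑ j, P i j ≤ 1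
  rate_sum : ∑ i, (lam i + mu i) = 1

namespace JacksonNetwork

variable {d : ℕ}

/-- Queue-length vectors. -/
abbrev State (d : ℕ) : Type := Fin d → ℕ

/-- Events of the embedded chain: `inl i` is an arrival at station `i`, `inr (inl i)` is a service
at `i` after which the job leaves the system, `inr (inr (i, j))` is a service at `i` after which
the job is routed to `j`. -/
abbrev Move (d : ℕ) : Type := Fin d ⊕ (Fin d ⊕ (Fin d × Fin d))

/-- The probability `P_{i,0}` of leaving the system after service at `i`. -/
def exitProb (N : JacksonNetwork d) (i : Fin d) : ℝ := 1 - ∑ j, N.P i j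

/-- Probabilities of the events. -/
def moveProb (N : JacksonNetwork d) : Move d → ℝ
  | Sum.inl i => N.lam i
  | Sum.inr (Sum.inl i) => N.mu i * N.exitProb i
  | Sum.inr (Sum.inr (i, j)) => N.mu i * N.P i j

theorem moveProb_nonneg (N : JacksonNetwork d) (w : Move d) : 0 ≤ N.moveProb w := by
  rcases w with i | i | ⟨i, j⟩
  · exact N.lam_nonneg i
  · exact mul_nonneg (N.mu_pos i).le (sub_nonneg.2 (N.P_row_le i))
  · exact mul_nonneg (N.mu_pos i).le (N.P_nonneg i j)

theorem sum_moveProb (N : JacksonNetwork d) : ∑ w, N.moveProb w = 1 := by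
  rw [← N.rate_sum, Fintype.sum_sum_type, Fintype.sum_sum_type, Fintype.sum_prod_type,
    ← Finset.sum_add_distrib, ← Finset.sum_add_distrib]
  refine Finset.sum_congr rfl fun i _ => ?_
  simp only [moveProb, exitProb, ← Finset.mul_sum]
  ring

/-- The common law of the i.i.d. events `Y(1), Y(2), …` that drive the embedded chain. -/
noncomputable def movePMF (N : JacksonNetwork d) : PMF (Move d) :=
  PMF.ofFintype (fun w => ENNReal.ofReal (N.moveProb w)) (by
    rw [← ENNReal.ofReal_sum_of_nonneg fun w _ => N.moveProb_nonneg w, N.sum_moveProb,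
      ENNReal.ofReal_one])

/-- The effect `x ↦ x + ζ(x, w)` of an event: a service at an empty station changes nothing. -/
def step (x : State d) : Move d → State d
  | Sum.inl i => x + Pi.single i 1
  | Sum.inr (Sum.inl i) => if x i = 0 then x else x - Pi.single i 1
  | Sum.inr (Sum.inr (i, j)) => if x i = 0 then x else x - Pi.single i 1 + Pi.single j 1

/-- The queue-length process started at `x` and driven by the events `y`. -/
def path (x : State d) (y : ℕ → Move d) : ℕ → State d
  | 0 => x
  | k + 1 => step (path x y k) (y k)

/-- The transition law of the embedded chain. -/
noncomputable def transition (N : JacksonNetwork d) (x : State d) : PMF (State d) :=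
  N.movePMF.map (step x)

/-- The network is open: every station receives jobs from outside (directly or through other
stations), and every job can leave the system (directly or through other stations). -/
def IsOpen (N : JacksonNetwork d) : Prop :=
  (∀ i, ∃ j, 0 < N.lam j ∧ Relation.ReflTransGen (fun a b => 0 < N.P a b) j i) ∧
  (∀ i, ∃ j, Relation.ReflTransGen (fun a b => 0 < N.P a b) i j ∧ 0 < N.exitProb j)

/-- The network is stable: a stationary distribution exists. -/
def IsStable (N : JacksonNetwork d) : Prop :=
  ∃ ν : PMF (State d), ν.bind N.transition = ν

/-- The traffic intensities `ρ_i = [λᵀ (I - P)⁻¹]_i / μ_i`. -/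
noncomputable def rho (N : JacksonNetwork d) (i : Fin d) : ℝ :=
  Matrix.vecMul N.lam ((1 - N.P)⁻¹) i / N.mu i

/-- The number `β` of bottleneck stations, those of maximal traffic intensity. -/
noncomputable def numBottlenecks (N : JacksonNetwork d) : ℕ :=
  {i : Fin d | ∀ j, N.rho j ≤ N.rho i}.ncard

/-- The maximal traffic intensity among the stations in `v`. -/
noncomputable def rhoMax (N : JacksonNetwork d) (v : Finset (Fin d)) (hv : v.Nonempty) : ℝ :=
  v.sup' hv N.rho

/-- The total population `V(x)` of the stations in `v`. -/
def population (v : Finset (Fin d)) (x : State d) : ℕ := ∑ i ∈ v, x i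

/-- `inf {k ≥ 1 : q k ∈ A}`, equal to `∞` if there is no such `k`. -/
noncomputable def returnTime (A : Set (State d)) (q : ℕ → State d) : ℕ∞ :=
  sInf {t : ℕ∞ | ∃ k : ℕ, 1 ≤ k ∧ q k ∈ A ∧ t = k}

/-- The law of an i.i.d. sequence of events. -/
noncomputable def seqLaw (N : JacksonNetwork d) : MeasureTheory.Measure (ℕ → Move d) :=
  MeasureTheory.Measure.infinitePi fun _ : ℕ => N.movePMF.toMeasure

/-- The overflow probability `p_n^V(x) = P_x(T_n^V ≤ T_{0})`. -/
noncomputable def overflowProb (N : JacksonNetwork d) (v : Finset (Fin d)) (n : ℕ)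
    (x : State d) : ℝ :=
  N.seqLaw.real {y | returnTime {z | n ≤ population v z} (path x y) ≤ returnTime {0} (path x y)}

/-- The affine function `W(y) = ∑ i, y_i log ρ_i - log ρ_*^V`. -/
noncomputable def subsolution (N : JacksonNetwork d) (v : Finset (Fin d)) (hv : v.Nonempty)
    (y : Fin d → ℝ) : ℝ :=
  ∑ i, Real.log (N.rho i) * y i - Real.log (N.rhoMax v hv)

/-- The importance function `U = Δ W / log r`. -/
noncomputable def importance (N : JacksonNetwork d) (v : Finset (Fin d)) (hv : v.Nonempty)
    (r : ℕ) (Δ : ℝ) (y : Fin d → ℝ) : ℝ :=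
  Δ * N.subsolution v hv y / Real.log r

/-- The nested sets `C_0 ⊆ C_1 ⊆ …`: `C_0` is the overflow set `{V ≥ n}`, and `C_j` for `j ≥ 1`
is obtained from it by adding the points `x` with `U(x / n) ≤ j Δ / n`. -/
def levelSet (N : JacksonNetwork d) (v : Finset (Fin d)) (hv : v.Nonempty) (r : ℕ) (Δ : ℝ)
    (n j : ℕ) : Set (State d) :=
  {x | n ≤ population v x ∨
    (1 ≤ j ∧ N.importance v hv r Δ (fun i => (x i : ℝ) / n) ≤ j * Δ / n)}

/-- The initial level `l_n(x) = min {j ≥ 0 : x ∈ C_j}`. -/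
noncomputable def level (N : JacksonNetwork d) (v : Finset (Fin d)) (hv : v.Nonempty) (r : ℕ)
    (Δ : ℝ) (n : ℕ) (x : State d) : ℕ :=
  sInf {j | x ∈ N.levelSet v hv r Δ n j}

/-- A particle that follows the trajectory `q` reaches `A` (possibly at once) before it hits `0`
(after its start). -/
def Reaches (A : Set (State d)) (q : ℕ → State d) : Prop :=
  ∃ t, q t ∈ A ∧ ∀ s, 1 ≤ s → s ≤ t → q s ≠ 0

/-- The number of descendants in the set `C 0` of one particle under the splitting algorithm. The
particle has the label `σ`, starts at `z` and is driven by its own events `ω (σ, 0), ω (σ, 1), …`.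
Its level is `k`. If `k = 0` it has arrived and is counted. Otherwise it evolves until it hits `0`, and dies, or
reaches `C (k - 1)`, where it is replaced by `r` children (labels `i :: σ`) at the point where it
entered that set. -/
noncomputable def survivors (r : ℕ) (C : ℕ → Set (State d))
    (ω : List (Fin r) × ℕ → Move d) : ℕ → List (Fin r) → State d → ℕ
  | 0, _, _ => 1
  | k + 1, σ, z =>
    open Classical in
    let q := path z fun t => ω (σ, t)
    if Reaches (C k) q then
      ∑ i : Fin r, survivors r C ω k (i :: σ) (q (sInf {t | q t ∈ C k}))
    else 0

/-- The law of the events that drive all particles: independent i.i.d. sequences, one for each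
label in the `r`-ary tree. -/
noncomputable def treeLaw (N : JacksonNetwork d) (r : ℕ) :
    MeasureTheory.Measure (List (Fin r) × ℕ → Move d) :=
  MeasureTheory.Measure.infinitePi fun _ : List (Fin r) × ℕ => N.movePMF.toMeasure

/-- The splitting estimator `R_n(x) = N_n(x) / r ^ l_n(x)`, where `N_n(x)` is the number of
particles that survive up to `C_0`. -/
noncomputable def estimator (N : JacksonNetwork d) (v : Finset (Fin d)) (hv : v.Nonempty)
    (r : ℕ) (Δ : ℝ) (n : ℕ) (x : State d) (ω : List (Fin r) × ℕ → Move d) : ℝ :=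
  (survivors r (N.levelSet v hv r Δ n) ω (N.level v hv r Δ n x) [] x : ℝ) /
    (r : ℝ) ^ N.level v hv r Δ n x

end JacksonNetwork

/-! Let p(z) be the probability of reaching {V ≥ n} from z before 0 is hit, and write ρ^z = ∏
ρ_i^{z_i}. The core is the bound ε ρ^z p(z) ≤ p(0), with ε independent of z and n
(`exists_invariant_mul_le`). It holds because the chain from 0 meets z before its return to 0 with
probability at least ε ρ^z, and p is superharmonic for the chain killed at 0. To get this hitting
probability, test the invariance of the product-form measure (`tsum_invariant_mul_avg`) against h,
the probability of hitting z before 0. All terms cancel except those at 0 and z, which leaves h(0) =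
ρ^z (1 - q), where q is the probability of returning to z before 0. A Lyapunov function that
contracts along the killed chain (`exists_geometric_drift_killed`), built from exponentials of
workloads, gives q ≤ 1 - ε uniformly in z. Stability enters only through ρ_i < 1 (`rho_lt_one`).

By `mem_levelSet_iff`, ρ^z > r^j ρ_*^n for z outside C_j, j ≥ 1, where ρ_* stands for ρ_*^V. Hence,
where a particle steps into C_j from outside, r^j p is at most B = p(0) / (ε c ρ_*^n), with c the
smallest traffic intensity; r^j p bounds the mean number of survivors. Since siblings are
independent, each level adds at most rB times r^l p(x) to the second moment of N_n, which is
therefore at most (1 + l r B) r^l p(x) with l = l_n(x) (`lintegral_count_sq_le_of_notMem`). Divide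
by r^{2l} and use ρ^x ≤ r^l ρ_*^n together with ε ρ_*^n ≤ p(0) ≤ p(x): the result is O(l) p(x)^2.
Finally l = O(n), so the growth is at most linear, and β ≥ 1 gives the claim. -/

open scoped ENNReal

namespace JacksonNetwork

variable {d : ℕ}

/-! ### Routing matrix and traffic equations. -/

/-- Minimum principle for the routing matrix of an open network. -/
theorem nonneg_of_superharmonic (N : JacksonNetwork d) (hN : N.IsOpen) (u : Fin d → ℝ)
    (h : ∀ i, ∑ j, N.P i j * u j ≤ u i) (i : Fin d) : 0 ≤ u i := by
  have : Nonempty (Fin d) := ⟨i⟩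
  obtain ⟨a, ha⟩ := Finite.exists_min u
  by_contra hi
  have hneg : u a < 0 := (ha i).trans_lt (not_le.1 hi)
  -- At a minimizer the left side is nonnegative and the right side nonpositive. Hence the minimum
  -- spreads along every routing edge, until a station with positive exit probability makes the
  -- right side negative.
  have key : ∀ b, u b = u a → ∑ j, N.P b j * (u j - u a) ≤ u a * N.exitProb b := by
    intro b hb
    have := h b
    simp only [mul_sub, Finset.sum_sub_distrib, ← Finset.sum_mul, exitProb]
    rw [hb] at this
    linarith
  have hterm : ∀ b j, 0 ≤ N.P b j * (u j - u a) := fun b j =>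
    mul_nonneg (N.P_nonneg b j) (sub_nonneg.2 (ha j))
  have hexit : ∀ b, 0 ≤ N.exitProb b := fun b => sub_nonneg.2 (N.P_row_le b)
  obtain ⟨b, hab, hb⟩ := hN.2 a
  have hconst : u b = u a := by
    clear hb
    induction hab with
    | refl => rfl
    | @tail b c _ hbc ih =>
      have h1 := key b ih
      have h2 : N.P b c * (u c - u a) ≤ ∑ j, N.P b j * (u j - u a) :=
        Finset.single_le_sum (f := fun j => N.P b j * (u j - u a)) (fun j _ => hterm b j)
          (Finset.mem_univ c)
      have h3 : u a * N.exitProb b ≤ 0 := mul_nonpos_of_nonpos_of_nonneg hneg.le (hexit b)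
      have h4 : N.P b c * (u c - u a) = 0 := le_antisymm (by linarith) (hterm b c)
      rcases mul_eq_zero.1 h4 with h5 | h5
      · exact absurd h5 hbc.ne'
      · linarith
  have h1 := key b hconst
  have h2 : 0 ≤ ∑ j, N.P b j * (u j - u a) := Finset.sum_nonneg fun j _ => hterm b j
  have h3 : u a * N.exitProb b < 0 := mul_neg_of_neg_of_pos hneg hb
  linarith

/-- A kernel vector is harmonic, so the minimum principle applies to it and to its negative. -/
theorem isUnit_det_one_sub (N : JacksonNetwork d) (hN : N.IsOpen) : IsUnit (1 - N.P).det := by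
  rw [isUnit_iff_ne_zero]
  intro h0
  obtain ⟨u, hu, hu0⟩ := Matrix.exists_mulVec_eq_zero_iff.2 h0
  have hfix : ∀ i, ∑ j, N.P i j * u j = u i := by
    intro i
    have := congrFun hu0 i
    rw [Matrix.sub_mulVec, Matrix.one_mulVec] at this
    simp only [Pi.sub_apply, Pi.zero_apply, Matrix.mulVec, dotProduct] at this
    linarith
  apply hu
  funext i
  have h1 := N.nonneg_of_superharmonic hN u (fun i => (hfix i).le) i
  have h2 := N.nonneg_of_superharmonic hN (-u) (fun i => by simp [hfix]) i
  simp only [Pi.neg_apply, Pi.zero_apply] at h2 ⊢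
  linarith

/-- The matrix `(I - P)⁻¹` of expected numbers of visits. -/
noncomputable def visits (N : JacksonNetwork d) : Matrix (Fin d) (Fin d) ℝ := (1 - N.P)⁻¹

theorem visits_eq_left (N : JacksonNetwork d) (hN : N.IsOpen) (i j : Fin d) :
    N.visits i j = (if i = j then 1 else 0) + ∑ k, N.P i k * N.visits k j := by
  have h := Matrix.mul_nonsing_inv _ (N.isUnit_det_one_sub hN)
  have h2 := congrFun (congrFun h i) j
  rw [sub_mul, one_mul, Matrix.sub_apply, Matrix.mul_apply, Matrix.one_apply] at h2
  simp only [visits]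
  linarith

theorem visits_eq_right (N : JacksonNetwork d) (hN : N.IsOpen) (i j : Fin d) :
    N.visits i j = (if i = j then 1 else 0) + ∑ k, N.visits i k * N.P k j := by
  have h := Matrix.nonsing_inv_mul _ (N.isUnit_det_one_sub hN)
  have h2 := congrFun (congrFun h i) j
  rw [mul_sub, mul_one, Matrix.sub_apply, Matrix.mul_apply, Matrix.one_apply] at h2
  simp only [visits]
  linarith

theorem visits_nonneg (N : JacksonNetwork d) (hN : N.IsOpen) (i j : Fin d) :
    0 ≤ N.visits i j := by
  refine N.nonneg_of_superharmonic hN (fun i => N.visits i j) (fun i => ?_) i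
  have := N.visits_eq_left hN i j
  have h2 : (0 : ℝ) ≤ if i = j then 1 else 0 := by split_ifs <;> norm_num
  linarith

theorem one_le_visits_self (N : JacksonNetwork d) (hN : N.IsOpen) (i : Fin d) :
    1 ≤ N.visits i i := by
  rw [N.visits_eq_left hN i i, if_pos rfl]
  have : 0 ≤ ∑ k, N.P i k * N.visits k i :=
    Finset.sum_nonneg fun k _ => mul_nonneg (N.P_nonneg _ _) (N.visits_nonneg hN _ _)
  linarith

theorem visits_pos (N : JacksonNetwork d) (hN : N.IsOpen) {i j : Fin d}
    (h : Relation.ReflTransGen (fun a b => 0 < N.P a b) i j) : 0 < N.visits i j := by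
  induction h using Relation.ReflTransGen.head_induction_on with
  | refl => exact zero_lt_one.trans_le (N.one_le_visits_self hN j)
  | @head a b hab _ ih =>
    rw [N.visits_eq_left hN a j]
    have h1 : N.P a b * N.visits b j ≤ ∑ k, N.P a k * N.visits k j :=
      Finset.single_le_sum (f := fun k => N.P a k * N.visits k j)
        (fun k _ => mul_nonneg (N.P_nonneg _ _) (N.visits_nonneg hN _ _)) (Finset.mem_univ b)
    have h2 : (0 : ℝ) ≤ if a = j then 1 else 0 := by split_ifs <;> norm_num
    have h3 := mul_pos hab ih
    linarith

/-- The total arrival rates `λᵀ (I - P)⁻¹`. -/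
noncomputable def throughput (N : JacksonNetwork d) (j : Fin d) : ℝ :=
  ∑ i, N.lam i * N.visits i j

theorem rho_eq (N : JacksonNetwork d) (j : Fin d) : N.rho j = N.throughput j / N.mu j := rfl

theorem rho_mul_mu (N : JacksonNetwork d) (j : Fin d) : N.rho j * N.mu j = N.throughput j := by
  rw [rho_eq, div_mul_cancel₀ _ (N.mu_pos j).ne']

theorem throughput_eq (N : JacksonNetwork d) (hN : N.IsOpen) (j : Fin d) :
    N.throughput j = N.lam j + ∑ k, N.throughput k * N.P k j := by
  simp only [throughput, Finset.sum_mul]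
  rw [Finset.sum_comm]
  have h : ∀ i, N.lam i * N.visits i j =
      N.lam i * (if i = j then 1 else 0) + ∑ k, N.lam i * N.visits i k * N.P k j := by
    intro i
    conv_lhs => rw [N.visits_eq_right hN i j, mul_add, Finset.mul_sum]
    simp only [mul_assoc]
  rw [Finset.sum_congr rfl fun i _ => h i, Finset.sum_add_distrib]
  simp

theorem throughput_pos (N : JacksonNetwork d) (hN : N.IsOpen) (j : Fin d) :
    0 < N.throughput j := by
  obtain ⟨i, hi, hij⟩ := hN.1 j
  exact (mul_pos hi (N.visits_pos hN hij)).trans_le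
    (Finset.single_le_sum (f := fun i => N.lam i * N.visits i j)
      (fun k _ => mul_nonneg (N.lam_nonneg _) (N.visits_nonneg hN _ _)) (Finset.mem_univ i))

theorem rho_pos (N : JacksonNetwork d) (hN : N.IsOpen) (j : Fin d) : 0 < N.rho j :=
  div_pos (N.throughput_pos hN j) (N.mu_pos j)

/-- The traffic equations have only one solution. -/
theorem eq_throughput (N : JacksonNetwork d) (hN : N.IsOpen) (a : Fin d → ℝ)
    (ha : ∀ j, a j = N.lam j + ∑ k, a k * N.P k j) : a = N.throughput := by
  have h1 : Matrix.vecMul a (1 - N.P) = N.lam := by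
    funext j
    rw [Matrix.vecMul_sub, Matrix.vecMul_one]
    simp only [Pi.sub_apply, Matrix.vecMul, dotProduct]
    have := ha j
    linarith
  have h2 := congrArg (fun u => Matrix.vecMul u ((1 - N.P)⁻¹)) h1
  simp only [Matrix.vecMul_vecMul, Matrix.mul_nonsing_inv _ (N.isUnit_det_one_sub hN),
    Matrix.vecMul_one] at h2
  rw [h2]
  rfl

theorem sum_throughput_mul_exitProb (N : JacksonNetwork d) (hN : N.IsOpen) :
    ∑ i, N.throughput i * N.exitProb i = ∑ i, N.lam i := by
  have h : ∑ j, N.throughput j = ∑ j, N.lam j + ∑ j, ∑ k, N.throughput k * N.P k j := by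
    rw [← Finset.sum_add_distrib]
    exact Finset.sum_congr rfl fun j _ => N.throughput_eq hN j
  rw [Finset.sum_comm] at h
  simp only [exitProb, mul_sub, mul_one, Finset.sum_sub_distrib, Finset.mul_sum]
  linarith

/-! ### Single transitions: access to the empty state and drifts of linear functions. -/

theorem exists_eq_add_single {y : State d} {i : Fin d} (h : y i ≠ 0) :
    y = y - Pi.single i 1 + Pi.single i 1 := by
  funext k
  rcases eq_or_ne k i with rfl | hk
  · simp only [Pi.add_apply, Pi.sub_apply, Pi.single_eq_same]
    omega
  · simp [Pi.single_eq_of_ne hk]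

theorem sum_sub_single_lt {y : State d} {i : Fin d} (h : y i ≠ 0) :
    ∑ k, (y - Pi.single i 1 : State d) k < ∑ k, y k := by
  conv_rhs => rw [exists_eq_add_single h]
  simp [Finset.sum_add_distrib]

theorem sum_sub_single_add_single {y : State d} {i j : Fin d} (h : y i ≠ 0) :
    ∑ k, (y - Pi.single i 1 + Pi.single j 1 : State d) k = ∑ k, y k := by
  conv_rhs => rw [exists_eq_add_single h]
  simp [Finset.sum_add_distrib]

/-- The empty state can be reached from every state. -/
theorem reaches_zero (N : JacksonNetwork d) (hN : N.IsOpen) (y : State d) :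
    Relation.ReflTransGen (fun a b => ∃ w, 0 < N.moveProb w ∧ step a w = b) y 0 := by
  induction hn : ∑ k, y k using Nat.strong_induction_on generalizing y with
  | _ n ih =>
    subst hn
    by_cases hy : y = 0
    · subst hy; exact .refl
    obtain ⟨i, hi⟩ : ∃ i, y i ≠ 0 := by
      by_contra h
      push Not at h
      exact hy (funext h)
    -- The inner induction follows one job along a route to an exit. Routing keeps the total
    -- population, and the final departure lowers it.
    obtain ⟨j, hij, hj⟩ := hN.2 i
    induction hij using Relation.ReflTransGen.head_induction_on generalizing y with
    | refl =>
      refine .head ⟨Sum.inr (Sum.inl j), mul_pos (N.mu_pos j) hj, rfl⟩ ?_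
      simp only [step, if_neg hi]
      exact ih _ (sum_sub_single_lt hi) _ rfl
    | @head a b hab _ ihp =>
      refine .head ⟨Sum.inr (Sum.inr (a, b)), mul_pos (N.mu_pos a) hab, rfl⟩ ?_
      simp only [step, if_neg hi]
      have hb : (y - Pi.single a 1 + Pi.single b 1 : State d) b ≠ 0 := by simp
      refine ihp _ ?_ ?_ hb
      · intro m hm
        rw [sum_sub_single_add_single hi] at hm
        exact ih m hm
      · intro h0
        exact hb (by rw [h0]; rfl)

/-- The mean of `f` after one transition from `y`. -/
noncomputable def avg (N : JacksonNetwork d) (f : State d → ℝ) (y : State d) : ℝ :=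
  ∑ w, N.moveProb w * f (step y w)

theorem sum_move (f : Move d → ℝ) :
    ∑ w, f w = ∑ i, f (Sum.inl i) + (∑ i, f (Sum.inr (Sum.inl i)) +
      ∑ i, ∑ j, f (Sum.inr (Sum.inr (i, j)))) := by
  rw [Fintype.sum_sum_type, Fintype.sum_sum_type, Fintype.sum_prod_type]

/-- Linear functions of the state. -/
noncomputable def linear (u : Fin d → ℝ) (y : State d) : ℝ := ∑ i, u i * y i

/-- The increments of a linear function. -/
noncomputable def increment (u : Fin d → ℝ) (y : State d) : Move d → ℝ
  | Sum.inl i => u i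
  | Sum.inr (Sum.inl i) => if y i = 0 then 0 else - u i
  | Sum.inr (Sum.inr (i, j)) => if y i = 0 then 0 else u j - u i

theorem linear_add_single (u : Fin d → ℝ) (y : State d) (i : Fin d) :
    linear u (y + Pi.single i 1) = linear u y + u i := by
  simp only [linear, Pi.add_apply, Nat.cast_add, mul_add, Finset.sum_add_distrib]
  congr 1
  rw [Finset.sum_eq_single i]
  · simp
  · intro b _ hb; simp [Pi.single_eq_of_ne hb]
  · simp

theorem linear_step (u : Fin d → ℝ) (y : State d) (w : Move d) :
    linear u (step y w) = linear u y + increment u y w := by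
  have hsub : ∀ i, y i ≠ 0 → linear u (y - Pi.single i 1) = linear u y - u i := by
    intro i hi
    conv_rhs => rw [exists_eq_add_single hi, linear_add_single]
    ring
  rcases w with i | i | ⟨i, j⟩
  · exact linear_add_single u y i
  · simp only [step, increment]
    split_ifs with h
    · simp
    · rw [hsub i h]; ring
  · simp only [step, increment]
    split_ifs with h
    · simp
    · rw [linear_add_single, hsub i h]; ring

theorem abs_increment_le {u : Fin d → ℝ} {A : ℝ} (h0 : ∀ i, 0 ≤ u i) (hA : ∀ i, u i ≤ A)
    (y : State d) (w : Move d) : |increment u y w| ≤ A := by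
  rcases w with i | i | ⟨i, j⟩
  · rw [increment, abs_of_nonneg (h0 i)]; exact hA i
  · have := h0 i
    have := hA i
    rw [increment, abs_le]; split_ifs <;> constructor <;> linarith
  · have := h0 i
    have := hA i
    have := h0 j
    have := hA j
    rw [increment, abs_le]; split_ifs <;> constructor <;> linarith

/-- The drift of a linear function. -/
theorem sum_moveProb_mul_increment (N : JacksonNetwork d) (u : Fin d → ℝ) (y : State d) :
    ∑ w, N.moveProb w * increment u y w =
      ∑ i, N.lam i * u i +
        ∑ i, if y i = 0 then 0 else N.mu i * (∑ j, N.P i j * u j - u i) := by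
  rw [sum_move, ← Finset.sum_add_distrib (s := Finset.univ)
    (f := fun i => N.moveProb (Sum.inr (Sum.inl i)) * _)]
  congr 1
  refine Finset.sum_congr rfl fun i _ => ?_
  simp only [moveProb, increment, exitProb]
  split_ifs with h
  · simp
  · simp only [mul_sub, Finset.sum_sub_distrib, Finset.mul_sum, ← Finset.sum_mul, sub_mul]
    simp only [mul_assoc, mul_neg]
    simp only [← Finset.mul_sum]
    ring

theorem avg_sub (N : JacksonNetwork d) (f : State d → ℝ) (y : State d) :
    N.avg f y - f y = ∑ w, N.moveProb w * (f (step y w) - f y) := by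
  simp only [avg, mul_sub, Finset.sum_sub_distrib, ← Finset.sum_mul, N.sum_moveProb, one_mul]

/-! ### A stationary distribution forces every traffic intensity below one. -/

theorem tsum_stationary (N : JacksonNetwork d) {ν : PMF (State d)} (hν : ν.bind N.transition = ν)
    (f : State d → ENNReal) :
    ∑' y, ν y * ∑ w, N.movePMF w * f (step y w) = ∑' y, ν y * f y := by
  conv_rhs => rw [← hν]
  simp only [PMF.bind_apply, ← ENNReal.tsum_mul_right]
  rw [ENNReal.tsum_comm]
  refine tsum_congr fun a => ?_
  simp only [mul_assoc, ENNReal.tsum_mul_left]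
  congr 1
  simp only [transition, PMF.map_apply, tsum_fintype, Finset.sum_mul]
  rw [Summable.tsum_finsetSum fun _ _ => ENNReal.summable]
  refine Finset.sum_congr rfl fun w _ => ?_
  simp [ite_mul]

theorem movePMF_apply (N : JacksonNetwork d) (w : Move d) :
    N.movePMF w = ENNReal.ofReal (N.moveProb w) := rfl

theorem ofReal_avg (N : JacksonNetwork d) {f : State d → ℝ} (hf : ∀ y, 0 ≤ f y) (y : State d) :
    ENNReal.ofReal (N.avg f y) = ∑ w, N.movePMF w * ENNReal.ofReal (f (step y w)) := by
  rw [avg, ENNReal.ofReal_sum_of_nonneg fun w _ => mul_nonneg (N.moveProb_nonneg w) (hf _)]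
  refine Finset.sum_congr rfl fun w _ => ?_
  rw [ENNReal.ofReal_mul (N.moveProb_nonneg w), movePMF_apply]

theorem avg_nonneg (N : JacksonNetwork d) {f : State d → ℝ} (hf : ∀ y, 0 ≤ f y) (y : State d) :
    0 ≤ N.avg f y :=
  Finset.sum_nonneg fun w _ => mul_nonneg (N.moveProb_nonneg w) (hf _)

theorem avg_mono (N : JacksonNetwork d) {f g : State d → ℝ} (h : ∀ y, f y ≤ g y) (y : State d) :
    N.avg f y ≤ N.avg g y :=
  Finset.sum_le_sum fun w _ => mul_le_mul_of_nonneg_left (h _) (N.moveProb_nonneg w)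

theorem avg_const (N : JacksonNetwork d) (c : ℝ) (y : State d) :
    N.avg (fun _ => c) y = c := by
  simp only [avg, ← Finset.sum_mul, N.sum_moveProb, one_mul]

theorem summable_toReal (ν : PMF (State d)) : Summable fun y => (ν y).toReal :=
  ENNReal.summable_toReal ν.tsum_coe_ne_top

theorem tsum_stationary_real (N : JacksonNetwork d) {ν : PMF (State d)}
    (hν : ν.bind N.transition = ν) {f : State d → ℝ} {B : ℝ} (hf : ∀ y, 0 ≤ f y)
    (hB : ∀ y, f y ≤ B) : ∑' y, (ν y).toReal * (N.avg f y - f y) = 0 := by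
  have h := congrArg ENNReal.toReal (N.tsum_stationary hν fun y => ENNReal.ofReal (f y))
  simp only [← N.ofReal_avg hf] at h
  rw [ENNReal.tsum_toReal_eq fun y => ENNReal.mul_ne_top (ν.apply_ne_top y) ENNReal.ofReal_ne_top,
    ENNReal.tsum_toReal_eq fun y => ENNReal.mul_ne_top (ν.apply_ne_top y) ENNReal.ofReal_ne_top]
    at h
  simp only [ENNReal.toReal_mul, ENNReal.toReal_ofReal (hf _),
    ENNReal.toReal_ofReal (N.avg_nonneg hf _)] at h
  have hs : ∀ g : State d → ℝ, (∀ y, 0 ≤ g y) → (∀ y, g y ≤ B) →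
      Summable fun y => (ν y).toReal * g y := fun g h0 h1 =>
    Summable.of_nonneg_of_le (fun y => mul_nonneg ENNReal.toReal_nonneg (h0 y))
      (fun y => mul_le_mul_of_nonneg_left (h1 y) ENNReal.toReal_nonneg)
      ((summable_toReal ν).mul_right B)
  simp only [mul_sub]
  rw [(hs _ (N.avg_nonneg hf) fun y => (N.avg_mono hB y).trans_eq (N.avg_const B y)).tsum_sub
    (hs f hf hB), h, sub_self]

/-- Conservation of flow in stationarity. -/
theorem tsum_drift_eq_zero (N : JacksonNetwork d) {ν : PMF (State d)}
    (hν : ν.bind N.transition = ν) (i : Fin d) :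
    ∑' y, (ν y).toReal * ∑ w, N.moveProb w * increment (Pi.single i 1) y w = 0 := by
  classical
  have hlin : ∀ y : State d, linear (Pi.single i 1) y = y i := by
    intro y
    rw [linear, Finset.sum_eq_single i]
    · simp
    · intro b _ hb; simp [Pi.single_eq_of_ne hb]
    · simp
  have hstep : ∀ (y : State d) w, ((step y w i : ℕ) : ℝ) - y i = increment (Pi.single i 1) y w := by
    intro y w
    rw [← hlin, ← hlin, linear_step]; ring
  have hinc : ∀ (y : State d) w, |increment (Pi.single i (1 : ℝ)) y w| ≤ 1 := by
    refine abs_increment_le (fun k => ?_) (fun k => ?_)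
    all_goals rcases eq_or_ne k i with rfl | hk
    all_goals simp [*]
  -- The coordinate `y i` need not be integrable under `ν`, so it is truncated at `M`. Mean
  -- increments stay bounded by 1 uniformly in `M`, and dominated convergence removes the
  -- truncation.
  set f : ℕ → State d → ℝ := fun M y => min (y i : ℝ) M with hf
  have hbound : ∀ M y, |N.avg (f M) y - f M y| ≤ 1 := by
    intro M y
    rw [avg_sub]
    refine (Finset.abs_sum_le_sum_abs _ _).trans ?_
    rw [← N.sum_moveProb]
    refine Finset.sum_le_sum fun w _ => ?_
    rw [abs_mul, abs_of_nonneg (N.moveProb_nonneg w)]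
    refine mul_le_of_le_one_right (N.moveProb_nonneg w) ?_
    refine (abs_min_sub_min_le_max _ _ _ _).trans ?_
    rw [hstep]
    simp [hinc]
  have hlim : Filter.Tendsto (fun M => ∑' y, (ν y).toReal * (N.avg (f M) y - f M y))
      Filter.atTop (nhds (∑' y, (ν y).toReal *
        ∑ w, N.moveProb w * increment (Pi.single i 1) y w)) := by
    refine tendsto_tsum_of_dominated_convergence (summable_toReal ν) (fun y => ?_)
      (Filter.Eventually.of_forall fun M y => ?_)
    · refine tendsto_const_nhds.congr' ?_
      -- The extra 1 keeps the truncation invisible both at `y` and after one jump.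
      filter_upwards [Filter.eventually_ge_atTop (y i + 1)] with M hM
      rw [avg_sub]
      congr 1
      refine Finset.sum_congr rfl fun w _ => ?_
      congr 1
      have h1 := hinc y w
      have hM' : (y i : ℝ) + 1 ≤ M := by exact_mod_cast hM
      have h2 := (abs_le.1 h1).2
      rw [← hstep] at h2 ⊢
      simp only [hf]
      rw [min_eq_left (by linarith), min_eq_left (by linarith)]
    · rw [norm_mul, Real.norm_eq_abs, abs_of_nonneg ENNReal.toReal_nonneg, Real.norm_eq_abs]
      exact mul_le_of_le_one_right ENNReal.toReal_nonneg (hbound M y)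
  have hzero : ∀ M, ∑' y, (ν y).toReal * (N.avg (f M) y - f M y) = 0 := fun M =>
    N.tsum_stationary_real hν (B := M) (fun y => le_min (Nat.cast_nonneg _) (Nat.cast_nonneg _))
      (fun y => min_le_right _ _)
  simp only [hzero] at hlim
  exact (tendsto_nhds_unique hlim tendsto_const_nhds)

/-- The support of a stationary law is closed under moves of positive probability, and these lead to
0 from anywhere. -/
theorem stationary_zero_ne (N : JacksonNetwork d) (hN : N.IsOpen) {ν : PMF (State d)}
    (hν : ν.bind N.transition = ν) : ν 0 ≠ 0 := by
  obtain ⟨y, hy⟩ := ν.support_nonempty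
  have h := N.reaches_zero hN y
  rw [← PMF.mem_support_iff]
  generalize (0 : State d) = z at h ⊢
  induction h with
  | refl => exact hy
  | @tail a b _ hab ih =>
    obtain ⟨w, hw, rfl⟩ := hab
    rw [← hν, PMF.mem_support_bind_iff]
    refine ⟨a, ih, ?_⟩
    rw [transition, PMF.mem_support_map_iff]
    refine ⟨w, ?_, rfl⟩
    rw [PMF.mem_support_iff, movePMF_apply]
    simpa using hw

/-- In a stable open network all traffic intensities are less than one. -/
theorem rho_lt_one (N : JacksonNetwork d) (hN : N.IsOpen) (hS : N.IsStable) (i : Fin d) :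
    N.rho i < 1 := by
  classical
  obtain ⟨ν, hν⟩ := hS
  -- `b i` is the stationary probability that station `i` is busy. Conservation of flow says that `b
  -- i * mu i` solves the traffic equations, so `b` equals `rho` by uniqueness; it is below 1
  -- because `ν` charges the empty state.
  set b : Fin d → ℝ := fun i => ∑' y, (ν y).toReal * (if y i = 0 then 0 else 1) with hb
  have hs : ∀ i, Summable fun y : State d => (ν y).toReal * (if y i = 0 then (0 : ℝ) else 1) := by
    intro i
    refine Summable.of_nonneg_of_le (fun y => ?_) (fun y => ?_) (summable_toReal ν)
    · split_ifs <;> simp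
    · split_ifs <;> simp
  have hsum : ∑' y, (ν y).toReal = 1 := by
    rw [← ENNReal.tsum_toReal_eq fun y => ν.apply_ne_top y, ν.tsum_coe, ENNReal.toReal_one]
  have hflow : ∀ j, b j * N.mu j = N.lam j + ∑ k, (b k * N.mu k) * N.P k j := by
    intro j
    have h := N.tsum_drift_eq_zero hν j
    simp only [sum_moveProb_mul_increment] at h
    have h1 : ∀ y : State d, (ν y).toReal * (∑ i, N.lam i * Pi.single (M := fun _ => ℝ) j 1 i +
        ∑ i, if y i = 0 then 0 else N.mu i * (∑ k, N.P i k * Pi.single (M := fun _ => ℝ) j 1 k -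
          Pi.single (M := fun _ => ℝ) j 1 i)) =
        (ν y).toReal * N.lam j + ∑ i, (ν y).toReal * (if y i = 0 then (0 : ℝ) else 1) *
          (N.mu i * (N.P i j - Pi.single (M := fun _ => ℝ) j 1 i)) := by
      intro y
      rw [mul_add, Finset.mul_sum (Finset.univ)
        (fun i => if y i = 0 then 0 else N.mu i * (∑ k, N.P i k * Pi.single (M := fun _ => ℝ) j 1 k -
          Pi.single (M := fun _ => ℝ) j 1 i))]
      congr 1
      · simp [Pi.single_apply]
      · refine Finset.sum_congr rfl fun i _ => ?_
        simp only [Pi.single_apply]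
        split_ifs <;> simp
    simp only [h1] at h
    rw [Summable.tsum_add ((summable_toReal ν).mul_right _)
      (summable_sum fun i _ => (hs i).mul_right _), tsum_mul_right, hsum,
      Summable.tsum_finsetSum fun i _ => (hs i).mul_right _] at h
    simp only [tsum_mul_right] at h
    have h2 : ∑ i, b i * (N.mu i * (N.P i j - Pi.single (M := fun _ => ℝ) j 1 i)) =
        ∑ k, (b k * N.mu k) * N.P k j - b j * N.mu j := by
      simp only [mul_sub, Finset.sum_sub_distrib, Pi.single_apply]
      simp [mul_assoc]
    change 1 * N.lam j +
      ∑ i, b i * (N.mu i * (N.P i j - Pi.single (M := fun _ => ℝ) j 1 i)) = 0 at h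
    rw [h2] at h
    linarith
  have hthr := congrFun (N.eq_throughput hN (fun j => b j * N.mu j) hflow) i
  have hbi : b i = N.rho i := by
    rw [rho_eq, ← hthr, mul_div_cancel_right₀ _ (N.mu_pos i).ne']
  rw [← hbi, ← hsum]
  refine Summable.tsum_lt_tsum (i := 0) (fun y => ?_) ?_ (hs i) (summable_toReal ν)
  · split_ifs <;> simp
  · simp only [Pi.zero_apply, if_true, mul_zero]
    exact ENNReal.toReal_pos (N.stationary_zero_ne hN hν) (ν.apply_ne_top 0)

/-! ### Workloads and a Lyapunov function. -/

/-- Column sums of the matrix of expected visits. -/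
noncomputable def visitSum (N : JacksonNetwork d) (j : Fin d) : ℝ := ∑ i, N.visits i j

theorem one_le_visitSum (N : JacksonNetwork d) (hN : N.IsOpen) (j : Fin d) :
    1 ≤ N.visitSum j :=
  (N.one_le_visits_self hN j).trans (Finset.single_le_sum (f := fun i => N.visits i j)
    (fun i _ => N.visits_nonneg hN i j) (Finset.mem_univ j))

theorem visitSum_eq (N : JacksonNetwork d) (hN : N.IsOpen) (j : Fin d) :
    N.visitSum j = 1 + ∑ k, N.visitSum k * N.P k j := by
  simp only [visitSum, Finset.sum_mul]
  rw [Finset.sum_comm, Finset.sum_congr rfl fun i _ => N.visits_eq_right hN i j,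
    Finset.sum_add_distrib]
  simp

/-- The weights of the normalized workload at station `j`. -/
noncomputable def weight (N : JacksonNetwork d) (j i : Fin d) : ℝ :=
  N.visits i j / N.visitSum j

theorem weight_nonneg (N : JacksonNetwork d) (hN : N.IsOpen) (j i : Fin d) : 0 ≤ N.weight j i :=
  div_nonneg (N.visits_nonneg hN i j) (zero_le_one.trans (N.one_le_visitSum hN j))

theorem weight_le_one (N : JacksonNetwork d) (hN : N.IsOpen) (j i : Fin d) : N.weight j i ≤ 1 :=
  div_le_one_of_le₀ (Finset.single_le_sum (f := fun i => N.visits i j)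
    (fun i _ => N.visits_nonneg hN i j) (Finset.mem_univ i))
    (zero_le_one.trans (N.one_le_visitSum hN j))

/-- The normalized workload at station `j`. -/
noncomputable def workload (N : JacksonNetwork d) (j : Fin d) (y : State d) : ℝ :=
  linear (N.weight j) y

theorem workload_nonneg (N : JacksonNetwork d) (hN : N.IsOpen) (j : Fin d) (y : State d) :
    0 ≤ N.workload j y := by
  unfold workload linear
  exact Finset.sum_nonneg fun i _ => mul_nonneg (N.weight_nonneg hN j i) (Nat.cast_nonneg _)

/-- Column `j` of the visit matrix solves u = e_j + P u. Services at stations other than `j`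
therefore have no mean effect on this workload. -/
theorem workload_drift (N : JacksonNetwork d) (hN : N.IsOpen) (j : Fin d) (y : State d) :
    ∑ w, N.moveProb w * increment (N.weight j) y w =
      (N.throughput j - if y j = 0 then 0 else N.mu j) / N.visitSum j := by
  have hg : N.visitSum j ≠ 0 := (zero_lt_one.trans_le (N.one_le_visitSum hN j)).ne'
  rw [sum_moveProb_mul_increment]
  have h1 : ∑ i, N.lam i * N.weight j i = N.throughput j / N.visitSum j := by
    simp only [weight, throughput, Finset.sum_div, mul_div_assoc]
  have h2 : ∀ i, ∑ k, N.P i k * N.weight j k - N.weight j i =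
      -(if i = j then 1 else 0) / N.visitSum j := by
    intro i
    have := N.visits_eq_left hN i j
    simp only [weight, mul_div_assoc', ← Finset.sum_div]
    rw [← sub_div]
    congr 1
    linarith
  simp only [h1, h2]
  rw [Finset.sum_eq_single j, if_pos rfl]
  · split_ifs <;> ring
  · intro i _ hi
    simp [hi]
  · simp

/-- With no job at `j`, every job must pass through a predecessor before visiting `j`. The
unnormalized workload at `j` is then a nonnegative combination of the normalized ones with total
weight `visitSum j - 1`. An idle station thus stays below the maximum workload by a fixed factor. -/
theorem workload_le_of_idle (N : JacksonNetwork d) (hN : N.IsOpen) {j : Fin d} {y : State d}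
    {M : ℝ} (hM : ∀ i, N.workload i y ≤ M) (hj : y j = 0) :
    N.workload j y ≤ M * (1 - 1 / N.visitSum j) := by
  have hg : ∀ j, 0 < N.visitSum j := fun j => zero_lt_one.trans_le (N.one_le_visitSum hN j)
  have hw : ∀ i, N.workload i y * N.visitSum i = ∑ k, N.visits k i * y k := by
    intro i
    simp only [workload, linear, weight, Finset.sum_mul]
    refine Finset.sum_congr rfl fun k _ => ?_
    field_simp [(hg i).ne']
  have h1 : N.workload j y * N.visitSum j =
      ∑ i, N.workload i y * N.visitSum i * N.P i j := by
    simp only [hw, Finset.sum_mul]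
    rw [Finset.sum_comm]
    refine Finset.sum_congr rfl fun k _ => ?_
    rw [N.visits_eq_right hN k j, add_mul, Finset.sum_mul]
    rcases eq_or_ne k j with rfl | hk
    · simp [hj]
    · rw [if_neg hk, zero_mul, zero_add]
      exact Finset.sum_congr rfl fun i _ => by ring
  have h2 : ∑ i, N.workload i y * N.visitSum i * N.P i j ≤
      ∑ i, M * (N.visitSum i * N.P i j) := by
    refine Finset.sum_le_sum fun i _ => ?_
    rw [mul_assoc]
    exact mul_le_mul_of_nonneg_right (hM i) (mul_nonneg (hg i).le (N.P_nonneg i j))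
  rw [← Finset.mul_sum] at h2
  have h3 := N.visitSum_eq hN j
  have h4 : N.workload j y * N.visitSum j ≤ M * (N.visitSum j - 1) := by
    rw [h1]
    refine h2.trans (le_of_eq ?_)
    rw [h3]; ring
  rw [one_sub_div (hg j).ne', mul_div_assoc', le_div_iff₀ (hg j)]
  exact h4

theorem avg_sum (N : JacksonNetwork d) {ι : Type*} (s : Finset ι) (f : ι → State d → ℝ)
    (y : State d) : N.avg (fun y => ∑ i ∈ s, f i y) y = ∑ i ∈ s, N.avg (f i) y := by
  simp only [avg, Finset.mul_sum]
  exact Finset.sum_comm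

/-- This is e^t ≤ 1 + t + t^2 for |t| ≤ 1, applied to the increments. -/
theorem avg_exp_linear_le (N : JacksonNetwork d) {u : Fin d → ℝ} (h0 : ∀ i, 0 ≤ u i)
    (h1 : ∀ i, u i ≤ 1) {θ : ℝ} (hθ0 : 0 ≤ θ) (hθ1 : θ ≤ 1) (y : State d) :
    N.avg (fun y => Real.exp (θ * linear u y)) y ≤
      Real.exp (θ * linear u y) *
        (1 + θ * ∑ w, N.moveProb w * increment u y w + θ ^ 2) := by
  have hexp : ∀ w, Real.exp (θ * linear u (step y w)) ≤
      Real.exp (θ * linear u y) * (1 + θ * increment u y w + θ ^ 2) := by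
    intro w
    rw [linear_step, mul_add, Real.exp_add]
    refine mul_le_mul_of_nonneg_left ?_ (Real.exp_pos _).le
    have h2 := abs_increment_le h0 h1 y w
    have h3 : |θ * increment u y w| ≤ θ := by
      rw [abs_mul, abs_of_nonneg hθ0]
      exact mul_le_of_le_one_right hθ0 h2
    have h4 := (abs_le.1 (Real.abs_exp_sub_one_sub_id_le (h3.trans hθ1))).2
    have h5 : (θ * increment u y w) ^ 2 ≤ θ ^ 2 := by
      rw [← sq_abs]
      exact pow_le_pow_left₀ (abs_nonneg _) h3 2
    linarith
  calc N.avg (fun y => Real.exp (θ * linear u y)) y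
      ≤ ∑ w, N.moveProb w *
          (Real.exp (θ * linear u y) * (1 + θ * increment u y w + θ ^ 2)) :=
        Finset.sum_le_sum fun w _ =>
          mul_le_mul_of_nonneg_left (hexp w) (N.moveProb_nonneg w)
    _ = Real.exp (θ * linear u y) * (∑ w, N.moveProb w * 1 +
          θ * ∑ w, N.moveProb w * increment u y w + (∑ w, N.moveProb w) * θ ^ 2) := by
        rw [Finset.mul_sum, Finset.sum_mul, ← Finset.sum_add_distrib, ← Finset.sum_add_distrib,
          Finset.mul_sum]
        exact Finset.sum_congr rfl fun w _ => by ring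
    _ = _ := by simp only [mul_one, N.sum_moveProb, one_mul]

theorem sum_lam_le_one (N : JacksonNetwork d) : ∑ i, N.lam i ≤ 1 := by
  rw [← N.rate_sum]
  exact Finset.sum_le_sum fun i _ => le_add_of_nonneg_right (N.mu_pos i).le

/-- Geometric drift outside a finite set. -/
theorem exists_geometric_drift [NeZero d] (N : JacksonNetwork d) (hN : N.IsOpen)
    (hρ : ∀ i, N.rho i < 1) :
    ∃ (F : State d → ℝ) (ε : ℝ) (B : Set (State d)), 0 < ε ∧ B.Finite ∧ (∀ y, 1 ≤ F y) ∧
      ∀ y ∉ B, N.avg F y ≤ (1 - ε) * F y := by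
  have hg : ∀ j, 0 < N.visitSum j := fun j => zero_lt_one.trans_le (N.one_le_visitSum hN j)
  have hgap : ∀ j, 0 < (N.mu j - N.throughput j) / N.visitSum j := by
    intro j
    refine div_pos ?_ (hg j)
    have h1 := hρ j
    rw [rho_eq, div_lt_one (N.mu_pos j)] at h1
    linarith
  obtain ⟨j₀, hj₀⟩ := Finite.exists_min fun j => (N.mu j - N.throughput j) / N.visitSum j
  obtain ⟨j₁, hj₁⟩ := Finite.exists_min fun j => 1 / N.visitSum j
  set κ := 1 / N.visitSum j₁ with hκ
  have hκ0 : 0 < κ := one_div_pos.2 (hg j₁)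
  -- The factor 2 lets the first-order gain 2a^2 at a busy station absorb the second-order error a^2
  -- and leave a net loss a^2.
  obtain ⟨a, ha0, ha1, ha⟩ : ∃ a : ℝ, 0 < a ∧ a ≤ 1 ∧
      ∀ j, 2 * a ≤ (N.mu j - N.throughput j) / N.visitSum j := by
    refine ⟨min 1 ((N.mu j₀ - N.throughput j₀) / N.visitSum j₀ / 2),
      lt_min one_pos (half_pos (hgap j₀)), min_le_left _ _, fun j => ?_⟩
    have := min_le_right 1 ((N.mu j₀ - N.throughput j₀) / N.visitSum j₀ / 2)
    have := hj₀ j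
    linarith
  -- Beyond this threshold the idle stations together contribute at most a^2/2 times the whole sum:
  -- each of the `d` terms is smaller than the largest one by a factor exp(-aκM).
  obtain ⟨M₀, hM₀0, hM₀⟩ : ∃ M₀ : ℝ, 0 ≤ M₀ ∧
      ∀ M, M₀ ≤ M → 3 * d * Real.exp (-(a * κ * M)) ≤ a / 2 := by
    have h1 : Filter.Tendsto (fun M : ℝ => 3 * d * Real.exp (-(a * κ * M))) Filter.atTop
        (nhds (3 * d * 0)) :=
      (Real.tendsto_exp_neg_atTop_nhds_zero.comp
        (Filter.tendsto_id.const_mul_atTop (mul_pos ha0 hκ0))).const_mul _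
    rw [mul_zero] at h1
    obtain ⟨M₀, h⟩ := Filter.eventually_atTop.1 (h1.eventually (ge_mem_nhds (half_pos ha0)))
    exact ⟨max M₀ 0, le_max_right _ _, fun M hM => h M ((le_max_left _ _).trans hM)⟩
  set e : Fin d → State d → ℝ := fun j y => Real.exp (a * N.workload j y) with he
  have he0 : ∀ j y, 0 < e j y := fun j y => Real.exp_pos _
  refine ⟨fun y => ∑ j, e j y, a ^ 2 / 2, {y | ∀ j, N.workload j y < M₀}, by positivity,
    ?_, ?_, ?_⟩
  · refine Set.Finite.subset (Set.finite_Iic fun j => ⌈M₀ * N.visitSum j⌉₊) fun y hy j => ?_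
    have h1 := hy j
    have h2 : N.weight j j * y j ≤ N.workload j y :=
      Finset.single_le_sum (f := fun i => N.weight j i * (y i : ℝ))
        (fun i _ => mul_nonneg (N.weight_nonneg hN j i) (Nat.cast_nonneg _)) (Finset.mem_univ j)
    have h3 : 1 / N.visitSum j * y j ≤ N.weight j j * y j :=
      mul_le_mul_of_nonneg_right
        (div_le_div_of_nonneg_right (N.one_le_visits_self hN j) (hg j).le) (Nat.cast_nonneg _)
    have h4 : 1 / N.visitSum j * y j < M₀ := by linarith
    rw [one_div_mul_eq_div, div_lt_iff₀ (hg j)] at h4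
    exact_mod_cast h4.le.trans (Nat.le_ceil _)
  · intro y
    refine le_trans ?_ (Finset.single_le_sum (f := fun j => e j y) (fun j _ => (he0 j y).le)
      (Finset.mem_univ j₀))
    exact Real.one_le_exp (mul_nonneg ha0.le (N.workload_nonneg hN _ _))
  · intro y hy
    simp only [Set.mem_ofPred_eq, not_forall, not_lt] at hy
    obtain ⟨j₂, hj₂⟩ := hy
    obtain ⟨k, hk⟩ := Finite.exists_max fun j => N.workload j y
    set M := N.workload k y with hM
    have hMM : M₀ ≤ M := hj₂.trans (hk j₂)
    have hexpM : Real.exp (a * M) ≤ ∑ j, e j y :=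
      Finset.single_le_sum (f := fun j => e j y) (fun j _ => (he0 j y).le) (Finset.mem_univ k)
    have hterm : ∀ j, N.avg (e j) y ≤
        (1 - a ^ 2) * e j y + 3 * a * (Real.exp (-(a * κ * M)) * Real.exp (a * M)) := by
      intro j
      refine (N.avg_exp_linear_le (N.weight_nonneg hN j) (N.weight_le_one hN j) ha0.le ha1 y).trans
        ?_
      rw [N.workload_drift hN]
      change e j y * _ ≤ _
      split_ifs with hj
      · have h1 : (N.throughput j - 0) / N.visitSum j ≤ 1 := by
          rw [sub_zero, throughput, Finset.sum_div]
          refine le_trans (Finset.sum_le_sum fun i _ => ?_) N.sum_lam_le_one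
          rw [mul_div_assoc]
          exact mul_le_of_le_one_right (N.lam_nonneg i) (N.weight_le_one hN j i)
        have h2 : e j y ≤ Real.exp (-(a * κ * M)) * Real.exp (a * M) := by
          rw [← Real.exp_add]
          refine Real.exp_le_exp.2 ?_
          have h3 := N.workload_le_of_idle hN hk hj
          have h4 : M * (1 - 1 / N.visitSum j) ≤ M * (1 - κ) :=
            mul_le_mul_of_nonneg_left (sub_le_sub_left (hj₁ j) _) (hM₀0.trans hMM)
          nlinarith
        have h3 : 1 + a * ((N.throughput j - 0) / N.visitSum j) + a ^ 2 ≤ 1 - a ^ 2 + 3 * a := by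
          nlinarith
        calc _ ≤ e j y * (1 - a ^ 2 + 3 * a) := mul_le_mul_of_nonneg_left h3 (he0 j y).le
          _ = (1 - a ^ 2) * e j y + 3 * a * e j y := by ring
          _ ≤ _ := by gcongr
      · have h1 : (N.throughput j - N.mu j) / N.visitSum j ≤ -(2 * a) := by
          have := ha j
          rw [← neg_sub (N.mu j), neg_div]
          linarith
        have h3 : 1 + a * ((N.throughput j - N.mu j) / N.visitSum j) + a ^ 2 ≤ 1 - a ^ 2 := by
          nlinarith
        have h4 : 0 ≤ 3 * a * (Real.exp (-(a * κ * M)) * Real.exp (a * M)) := by positivity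
        nlinarith [mul_le_mul_of_nonneg_left h3 (he0 j y).le]
    rw [avg_sum]
    have hF0 : 0 ≤ ∑ j, e j y := (Real.exp_pos _).le.trans hexpM
    have h5 := hM₀ M hMM
    calc ∑ j, N.avg (e j) y
        ≤ ∑ j, ((1 - a ^ 2) * e j y +
            3 * a * (Real.exp (-(a * κ * M)) * Real.exp (a * M))) :=
          Finset.sum_le_sum fun j _ => hterm j
      _ = (1 - a ^ 2) * ∑ j, e j y +
            a * ((3 * d * Real.exp (-(a * κ * M))) * Real.exp (a * M)) := by
          rw [Finset.sum_add_distrib, ← Finset.mul_sum, Finset.sum_const, Finset.card_univ,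
            Fintype.card_fin, nsmul_eq_mul]
          ring
      _ ≤ (1 - a ^ 2) * ∑ j, e j y + a * (a / 2 * ∑ j, e j y) := by gcongr
      _ = _ := by ring

/-! ### The chain killed at the empty state. -/

/-- Set a function to zero at the empty state. -/
def kill {α : Type*} [Zero α] (f : State d → α) (y : State d) : α :=
  open Classical in if y = 0 then 0 else f y

theorem kill_zero {α : Type*} [Zero α] (f : State d → α) : kill f 0 = 0 := if_pos rfl

theorem kill_of_ne {α : Type*} [Zero α] (f : State d → α) {y : State d} (h : y ≠ 0) :
    kill f y = f y := if_neg h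

theorem kill_nonneg {f : State d → ℝ} (hf : ∀ y, 0 ≤ f y) (y : State d) : 0 ≤ kill f y := by
  unfold kill; split_ifs
  · exact le_rfl
  · exact hf y

theorem kill_le_self {f : State d → ℝ} (hf : ∀ y, 0 ≤ f y) (y : State d) : kill f y ≤ f y := by
  unfold kill; split_ifs
  · exact hf y
  · exact le_rfl

theorem kill_mono {f g : State d → ℝ} (h : ∀ y, f y ≤ g y) (y : State d) :
    kill f y ≤ kill g y := by
  unfold kill; split_ifs
  · exact le_rfl
  · exact h y

/-- The probability that the empty state is not hit at times `1, …, n`. -/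
noncomputable def survival (N : JacksonNetwork d) : ℕ → State d → ℝ
  | 0 => fun _ => 1
  | n + 1 => N.avg (kill (N.survival n))

theorem survival_nonneg (N : JacksonNetwork d) (n : ℕ) (y : State d) : 0 ≤ N.survival n y := by
  induction n generalizing y with
  | zero => exact zero_le_one
  | succ n ih => exact N.avg_nonneg (kill_nonneg ih) y

theorem survival_succ_le (N : JacksonNetwork d) (n : ℕ) (y : State d) :
    N.survival (n + 1) y ≤ N.survival n y := by
  induction n generalizing y with
  | zero =>
    refine (N.avg_mono (kill_le_self fun _ => zero_le_one) y).trans_eq ?_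
    exact N.avg_const 1 y
  | succ n ih => exact N.avg_mono (kill_mono ih) y

theorem survival_antitone (N : JacksonNetwork d) (y : State d) :
    Antitone fun n => N.survival n y :=
  antitone_nat_of_succ_le fun n => N.survival_succ_le n y

theorem survival_le_one (N : JacksonNetwork d) (n : ℕ) (y : State d) : N.survival n y ≤ 1 :=
  N.survival_antitone y (Nat.zero_le n)

theorem survival_succ_lt_one (N : JacksonNetwork d) {n : ℕ} {y : State d} {w : Move d}
    (hw : 0 < N.moveProb w) (h : kill (N.survival n) (step y w) < 1) :
    N.survival (n + 1) y < 1 := by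
  rw [← N.sum_moveProb]
  refine Finset.sum_lt_sum (fun w _ => ?_) ⟨w, Finset.mem_univ w, ?_⟩
  · exact mul_le_of_le_one_right (N.moveProb_nonneg w)
      ((kill_le_self (N.survival_nonneg n) _).trans (N.survival_le_one n _))
  · exact mul_lt_of_lt_one_right hw h

theorem exists_survival_lt_one [NeZero d] (N : JacksonNetwork d) (hN : N.IsOpen) (y : State d) :
    ∃ n, N.survival n y < 1 := by
  have key : ∃ n, kill (N.survival n) y < 1 := by
    induction N.reaches_zero hN y using Relation.ReflTransGen.head_induction_on with
    | refl => exact ⟨0, by rw [kill_zero]; exact one_pos⟩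
    | head hab _ ih =>
      obtain ⟨w, hw, rfl⟩ := hab
      obtain ⟨n, hn⟩ := ih
      exact ⟨n + 1, (kill_le_self (N.survival_nonneg _) _).trans_lt
        (N.survival_succ_lt_one hw hn)⟩
  -- The start itself does not count as a hit of 0. From 0, a potential departure from an empty
  -- station leaves the state at 0, which is a return at time 1.
  by_cases hy : y = 0
  · subst hy
    obtain ⟨j, -, hj⟩ := hN.2 0
    refine ⟨1, N.survival_succ_lt_one (w := Sum.inr (Sum.inl j)) (mul_pos (N.mu_pos j) hj) ?_⟩
    have : step (0 : State d) (Sum.inr (Sum.inl j)) = 0 := rfl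
    rw [this, kill_zero]
    exact one_pos
  · exact key.imp fun n hn => by rwa [kill_of_ne _ hy] at hn

theorem exists_survival_le_of_finite [NeZero d] (N : JacksonNetwork d) (hN : N.IsOpen)
    {B : Set (State d)} (hB : B.Finite) :
    ∃ (n : ℕ) (δ : ℝ), 0 < δ ∧ ∀ y ∈ B, N.survival n y ≤ 1 - δ := by
  induction B, hB using Set.Finite.induction_on with
  | empty => exact ⟨0, 1, one_pos, by simp⟩
  | @insert b B _ _ ih =>
    obtain ⟨n, δ, hδ, h⟩ := ih
    obtain ⟨m, hm⟩ := N.exists_survival_lt_one hN b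
    refine ⟨max m n, min δ (1 - N.survival m b), lt_min hδ (sub_pos.2 hm), ?_⟩
    intro y hy
    rcases Set.mem_insert_iff.1 hy with rfl | hy
    · have h1 := N.survival_antitone y (le_max_left m n)
      have h2 := min_le_right δ (1 - N.survival m y)
      simp only at h1
      linarith
    · have h1 := N.survival_antitone y (le_max_right m n)
      have h2 := min_le_left δ (1 - N.survival m b)
      have h3 := h y hy
      simp only at h1
      linarith

/-- A function that decreases geometrically along the chain killed at the empty state. -/
theorem exists_geometric_drift_killed [NeZero d] (N : JacksonNetwork d) (hN : N.IsOpen)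
    (hρ : ∀ i, N.rho i < 1) :
    ∃ (G : State d → ℝ) (ε : ℝ), 0 < ε ∧ (∀ y, 1 ≤ G y) ∧
      ∀ y, N.avg (kill G) y ≤ (1 - ε) * G y := by
  obtain ⟨F, ε, B, hε, hB, hF1, hF⟩ := N.exists_geometric_drift hN hρ
  obtain ⟨n, δ, hδ, hn⟩ := N.exists_survival_le_of_finite hN hB
  have hF0 : ∀ y, 0 ≤ F y := fun y => zero_le_one.trans (hF1 y)
  obtain ⟨b, hb0, hb⟩ : ∃ b : ℝ, 0 ≤ b ∧ ∀ y ∈ B, N.avg F y ≤ b := by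
    obtain ⟨b, hb⟩ := (hB.image (N.avg F)).bddAbove
    exact ⟨max b 0, le_max_right _ _, fun y hy =>
      (hb (Set.mem_image_of_mem _ hy)).trans (le_max_left _ _)⟩
  -- The sum telescopes: one killed step turns `Φ` into `Φ - 1 + survival n`. This is a loss of at
  -- least `δ` on `B` and never a gain elsewhere, so a multiple of `Φ` repairs the drift of `F` on
  -- the finite set.
  set Φ : State d → ℝ := fun y => ∑ i ∈ Finset.range n, N.survival i y with hΦ
  have hΦ0 : ∀ y, 0 ≤ Φ y := fun y => Finset.sum_nonneg fun i _ => N.survival_nonneg i y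
  have hΦn : ∀ y, Φ y ≤ n := by
    intro y
    refine (Finset.sum_le_sum fun i _ => N.survival_le_one i y).trans_eq ?_
    simp
  have hKΦ : ∀ y, N.avg (kill Φ) y = Φ y - 1 + N.survival n y := by
    intro y
    have h1 : kill Φ = fun y => ∑ i ∈ Finset.range n, kill (N.survival i) y := by
      funext y
      unfold kill
      split_ifs <;> simp [hΦ]
    rw [h1, avg_sum]
    have h2 := Finset.sum_range_succ (fun i => N.survival i y) n
    rw [Finset.sum_range_succ'] at h2
    have h3 : N.survival 0 y = 1 := rfl
    simp only [hΦ]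
    change ∑ i ∈ Finset.range n, N.survival (i + 1) y = _
    linarith
  -- With this choice the loss `c * δ` on `B` exceeds the bound `b` for the mean of `F` by 1.
  set c := (b + 1) / δ with hc
  have hc0 : 0 ≤ c := by positivity
  have hcδ : c * δ = b + 1 := div_mul_cancel₀ _ hδ.ne'
  set G : State d → ℝ := fun y => F y + c * Φ y with hG
  have hG1 : ∀ y, 1 ≤ G y := fun y => (hF1 y).trans
    (le_add_of_nonneg_right (mul_nonneg hc0 (hΦ0 y)))
  have hKG : ∀ y, N.avg (kill G) y ≤ N.avg F y + c * (Φ y - 1 + N.survival n y) := by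
    intro y
    rw [← hKΦ, avg, avg, avg, Finset.mul_sum, ← Finset.sum_add_distrib]
    refine Finset.sum_le_sum fun w _ => ?_
    have : kill G (step y w) ≤ F (step y w) + c * kill Φ (step y w) := by
      unfold kill
      split_ifs
      · simpa using hF0 _
      · exact le_rfl
    calc _ ≤ N.moveProb w * (F (step y w) + c * kill Φ (step y w)) :=
          mul_le_mul_of_nonneg_left this (N.moveProb_nonneg w)
      _ = _ := by ring
  obtain ⟨R, hR0, hR⟩ : ∃ R : ℝ, 0 < R ∧ ∀ y ∈ B, G y ≤ R := by
    obtain ⟨b, hb⟩ := (hB.image G).bddAbove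
    exact ⟨max b 1, lt_max_of_lt_right one_pos, fun y hy =>
      (hb (Set.mem_image_of_mem _ hy)).trans (le_max_left _ _)⟩
  have hden : 0 < 1 + c * n := by positivity
  -- Outside `B` the loss `ε * F` is compared with `G` through `G ≤ (1 + c * n) * F`; inside `B` a
  -- loss of 1 is compared with `G ≤ R`.
  refine ⟨G, min (ε / (1 + c * n)) (1 / R), lt_min (div_pos hε hden) (one_div_pos.2 hR0), hG1,
    fun y => (hKG y).trans ?_⟩
  have hGy : 0 ≤ G y := zero_le_one.trans (hG1 y)
  by_cases hy : y ∈ B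
  · have h1 : min (ε / (1 + c * n)) (1 / R) * G y ≤ 1 := by
      calc _ ≤ 1 / R * R := mul_le_mul (min_le_right _ _) (hR y hy) hGy (by positivity)
        _ = 1 := by field_simp
    have h2 : c * N.survival n y ≤ c * (1 - δ) := mul_le_mul_of_nonneg_left (hn y hy) hc0
    have h3 := hb y hy
    have h4 := hF0 y
    have h5 : G y = F y + c * Φ y := rfl
    nlinarith
  · have h1 : min (ε / (1 + c * n)) (1 / R) * G y ≤ ε * F y := by
      have h2 : G y ≤ (1 + c * n) * F y := by
        have h5 : c * Φ y ≤ c * n := mul_le_mul_of_nonneg_left (hΦn y) hc0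
        have h6 : c * n ≤ c * n * F y := le_mul_of_one_le_right (by positivity) (hF1 y)
        have h7 : G y = F y + c * Φ y := rfl
        linarith
      calc _ ≤ ε / (1 + c * n) * ((1 + c * n) * F y) :=
            mul_le_mul (min_le_left _ _) h2 hGy (by positivity)
        _ = _ := by field_simp
    have h2 : c * N.survival n y ≤ c * 1 :=
      mul_le_mul_of_nonneg_left (N.survival_le_one n y) hc0
    have h3 := hF y hy
    have h5 : G y = F y + c * Φ y := rfl
    nlinarith

/-! ### The product-form measure. -/

/-- The invariant measure `y ↦ ∏ i, ρ_i ^ y_i`. -/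
noncomputable def invariant (N : JacksonNetwork d) (y : State d) : ℝ := ∏ i, N.rho i ^ y i

theorem invariant_pos (N : JacksonNetwork d) (hN : N.IsOpen) (y : State d) :
    0 < N.invariant y :=
  Finset.prod_pos fun i _ => pow_pos (N.rho_pos hN i) _

theorem invariant_zero (N : JacksonNetwork d) : N.invariant 0 = 1 := by
  simp [invariant]

theorem invariant_add_single (N : JacksonNetwork d) (y : State d) (i : Fin d) :
    N.invariant (y + Pi.single i 1) = N.rho i * N.invariant y := by
  simp only [invariant, Pi.add_apply, pow_add, Finset.prod_mul_distrib]
  rw [mul_comm]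
  congr 1
  rw [Finset.prod_eq_single i]
  · simp
  · intro b _ hb; simp [Pi.single_eq_of_ne hb]
  · simp

theorem summable_invariant (N : JacksonNetwork d) (hN : N.IsOpen) (hρ : ∀ i, N.rho i < 1) :
    Summable N.invariant := by
  classical
  have h0 : ∀ i, 0 ≤ N.rho i := fun i => (N.rho_pos hN i).le
  refine summable_of_sum_le (c := ∏ i, (1 - N.rho i)⁻¹)
    (fun y => (N.invariant_pos hN y).le) fun s => ?_
  obtain ⟨n, hn⟩ : ∃ n : ℕ, ∀ y ∈ s, ∀ i, y i < n := by
    refine ⟨s.sup (fun y => ∑ i, y i) + 1, fun y hy i => Nat.lt_succ_of_le ?_⟩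
    exact (Finset.single_le_sum (f := fun i => y i) (fun _ _ => Nat.zero_le _)
      (Finset.mem_univ i)).trans (Finset.le_sup (f := fun y : State d => ∑ i, y i) hy)
  calc ∑ y ∈ s, N.invariant y
      ≤ ∑ y ∈ Fintype.piFinset fun _ : Fin d => Finset.range n, N.invariant y :=
        Finset.sum_le_sum_of_subset_of_nonneg
          (fun y hy => Fintype.mem_piFinset.2 fun i => Finset.mem_range.2 (hn y hy i))
          fun y _ _ => (N.invariant_pos hN y).le
    _ = ∏ i, ∑ k ∈ Finset.range n, N.rho i ^ k := by
        rw [Finset.prod_univ_sum]; rfl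
    _ ≤ ∏ i, (1 - N.rho i)⁻¹ :=
        Finset.prod_le_prod (fun i _ => Finset.sum_nonneg fun k _ => pow_nonneg (h0 i) k)
          fun i _ => by
            rw [← tsum_geometric_of_lt_one (h0 i) (hρ i)]
            exact (summable_geometric_of_lt_one (h0 i) (hρ i)).sum_le_tsum _
              fun k _ => pow_nonneg (h0 i) k

theorem tsum_add_single (φ : State d → ℝ) (i : Fin d) :
    ∑' y : State d, φ (y + Pi.single i 1) = ∑' y : State d, if y i = 0 then 0 else φ y := by
  rw [← Function.Injective.tsum_eq (f := fun y : State d => if y i = 0 then 0 else φ y)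
    (g := fun y => y + Pi.single i 1) fun a b hab => add_right_cancel hab]
  · refine tsum_congr fun y => ?_
    simp
  · intro y hy
    refine ⟨y - Pi.single i 1, (exists_eq_add_single fun h => ?_).symm⟩
    simp [h] at hy

theorem summable_invariant_mul (N : JacksonNetwork d) (hN : N.IsOpen) (hρ : ∀ i, N.rho i < 1)
    {f : State d → ℝ} {B : ℝ} (hf : ∀ y, |f y| ≤ B) : Summable fun y => N.invariant y * f y :=
  Summable.of_norm_bounded ((N.summable_invariant hN hρ).mul_right B) fun y => by
    rw [norm_mul, Real.norm_eq_abs, abs_of_pos (N.invariant_pos hN y)]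
    exact mul_le_mul_of_nonneg_left (hf y) (N.invariant_pos hN y).le

theorem tsum_invariant_mul_add_single (N : JacksonNetwork d) (hN : N.IsOpen) (f : State d → ℝ)
    (i : Fin d) : ∑' y, N.invariant y * f (y + Pi.single i 1) =
      (N.rho i)⁻¹ * ∑' y, if y i = 0 then 0 else N.invariant y * f y := by
  rw [← tsum_add_single (fun y => N.invariant y * f y) i, ← tsum_mul_left]
  refine tsum_congr fun y => ?_
  rw [invariant_add_single, ← mul_assoc, ← mul_assoc, inv_mul_cancel₀ (N.rho_pos hN i).ne',
    one_mul]

theorem tsum_invariant_mul_service (N : JacksonNetwork d) (hN : N.IsOpen)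
    (hρ : ∀ i, N.rho i < 1) {f g : State d → ℝ} {B : ℝ} (hf : ∀ y, |f y| ≤ B)
    (hg : ∀ y, |g y| ≤ B) (i : Fin d) :
    ∑' y, N.invariant y * (if y i = 0 then f y else g (y - Pi.single i 1)) =
      (∑' y, if y i = 0 then N.invariant y * f y else 0) +
        N.rho i * ∑' y, N.invariant y * g y := by
  have h1 : ∑' y : State d, (if y i = 0 then 0 else
      N.invariant y * g (y - Pi.single i 1)) = N.rho i * ∑' y, N.invariant y * g y := by
    refine (tsum_add_single (fun y => N.invariant y * g (y - Pi.single i 1)) i).symm.trans ?_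
    rw [← tsum_mul_left]
    refine tsum_congr fun y => ?_
    rw [invariant_add_single, mul_assoc]
    congr 3
    funext k
    simp
  have hB : 0 ≤ B := (abs_nonneg _).trans (hf 0)
  have s1 := N.summable_invariant_mul hN hρ (f := fun y => if y i = 0 then f y else 0) (B := B)
    fun y => by split_ifs <;> simp [hf, hB]
  have s2 := N.summable_invariant_mul hN hρ
    (f := fun y => if y i = 0 then 0 else g (y - Pi.single i 1)) (B := B)
    fun y => by split_ifs <;> simp [hg, hB]
  rw [← h1]
  simp only [mul_ite, mul_zero] at s1 s2
  rw [← s1.tsum_add s2]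
  refine tsum_congr fun y => ?_
  split_ifs <;> simp

/-- The product-form measure is invariant. -/
theorem tsum_invariant_mul_avg (N : JacksonNetwork d) (hN : N.IsOpen) (hρ : ∀ i, N.rho i < 1)
    {f : State d → ℝ} {B : ℝ} (hf : ∀ y, |f y| ≤ B) :
    ∑' y, N.invariant y * N.avg f y = ∑' y, N.invariant y * f y := by
  set S := ∑' y, N.invariant y * f y with hS
  -- `Sp i` and `Sz i` are the parts of the sum where station `i` is busy and idle. The shift by a
  -- unit vector expresses every move through these and `S`; the traffic equations then collect the
  -- coefficient `mu j` at each `Sp j`, and the overall flow balance gives `∑ lam` at `S`.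
  set Sp : Fin d → ℝ := fun i => ∑' y : State d, if y i = 0 then 0 else N.invariant y * f y
    with hSp
  set Sz : Fin d → ℝ := fun i => ∑' y : State d, if y i = 0 then N.invariant y * f y else 0
    with hSz
  have hB : 0 ≤ B := (abs_nonneg _).trans (hf 0)
  have hsplit : ∀ i, Sz i + Sp i = S := by
    intro i
    have s1 := N.summable_invariant_mul hN hρ (f := fun y => if y i = 0 then f y else 0) (B := B)
      fun y => by split_ifs <;> simp [hf, hB]
    have s2 := N.summable_invariant_mul hN hρ (f := fun y => if y i = 0 then 0 else f y) (B := B)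
      fun y => by split_ifs <;> simp [hf, hB]
    simp only [mul_ite, mul_zero] at s1 s2
    rw [← s1.tsum_add s2]
    refine tsum_congr fun y => ?_
    split_ifs <;> simp
  have harr : ∀ i, ∑' y, N.invariant y * f (step y (Sum.inl i)) = (N.rho i)⁻¹ * Sp i :=
    fun i => N.tsum_invariant_mul_add_single hN f i
  have hexit : ∀ i, ∑' y, N.invariant y * f (step y (Sum.inr (Sum.inl i))) =
      Sz i + N.rho i * S := by
    intro i
    rw [← N.tsum_invariant_mul_service hN hρ hf hf i]
    refine tsum_congr fun y => ?_
    simp only [step, apply_ite f]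
  have hroute : ∀ i j, ∑' y, N.invariant y * f (step y (Sum.inr (Sum.inr (i, j)))) =
      Sz i + N.rho i * ((N.rho j)⁻¹ * Sp j) := by
    intro i j
    rw [← N.tsum_invariant_mul_add_single hN f j]
    refine Eq.trans ?_ (N.tsum_invariant_mul_service hN hρ hf
      (g := fun y => f (y + Pi.single j 1)) (fun y => hf _) i)
    refine tsum_congr fun y => ?_
    simp only [step, apply_ite f]
  have hswap : ∑' y, N.invariant y * N.avg f y =
      ∑ w, N.moveProb w * ∑' y, N.invariant y * f (step y w) := by
    simp only [← tsum_mul_left]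
    rw [← Summable.tsum_finsetSum fun w _ =>
      (N.summable_invariant_mul hN hρ (f := fun y => f (step y w)) fun y => hf _).mul_left _]
    refine tsum_congr fun y => ?_
    rw [avg, Finset.mul_sum]
    exact Finset.sum_congr rfl fun w _ => by ring
  rw [hswap, sum_move]
  simp only [harr, hexit, hroute, moveProb]
  have h1 : ∑ i, ∑ j, N.mu i * N.P i j * (Sz i + N.rho i * ((N.rho j)⁻¹ * Sp j)) =
      ∑ i, N.mu i * Sz i * ∑ j, N.P i j +
        ∑ j, (∑ i, N.throughput i * N.P i j) * ((N.rho j)⁻¹ * Sp j) := by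
    simp only [Finset.sum_mul, Finset.mul_sum]
    rw [Finset.sum_comm (f := fun j i => N.throughput i * N.P i j * ((N.rho j)⁻¹ * Sp j)),
      ← Finset.sum_add_distrib]
    refine Finset.sum_congr rfl fun i _ => ?_
    rw [← Finset.sum_add_distrib]
    refine Finset.sum_congr rfl fun j _ => ?_
    rw [← N.rho_mul_mu i]
    ring
  have h2 : ∀ j, N.lam j * ((N.rho j)⁻¹ * Sp j) +
      (∑ i, N.throughput i * N.P i j) * ((N.rho j)⁻¹ * Sp j) = N.mu j * Sp j := by
    intro j
    rw [← add_mul, ← N.throughput_eq hN j, ← N.rho_mul_mu j]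
    field_simp [(N.rho_pos hN j).ne']
  have h3 : ∑ i, N.mu i * N.exitProb i * (Sz i + N.rho i * S) =
      ∑ i, N.mu i * Sz i * N.exitProb i + (∑ i, N.lam i) * S := by
    rw [← N.sum_throughput_mul_exitProb hN, Finset.sum_mul, ← Finset.sum_add_distrib]
    refine Finset.sum_congr rfl fun i _ => ?_
    rw [← N.rho_mul_mu i]
    ring
  have h4 : ∑ i, N.mu i * Sz i * N.exitProb i + ∑ i, N.mu i * Sz i * ∑ j, N.P i j =
      ∑ i, N.mu i * Sz i := by
    rw [← Finset.sum_add_distrib]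
    refine Finset.sum_congr rfl fun i _ => ?_
    rw [exitProb]; ring
  have h5 : ∑ i, N.lam i * ((N.rho i)⁻¹ * Sp i) +
      ∑ j, (∑ i, N.throughput i * N.P i j) * ((N.rho j)⁻¹ * Sp j) = ∑ j, N.mu j * Sp j := by
    rw [← Finset.sum_add_distrib]
    exact Finset.sum_congr rfl fun j _ => h2 j
  have h6 : ∑ i, N.mu i * Sz i + ∑ j, N.mu j * Sp j = (∑ i, N.mu i) * S := by
    rw [← Finset.sum_add_distrib, Finset.sum_mul]
    exact Finset.sum_congr rfl fun j _ => by rw [← hsplit j]; ring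
  have h7 := N.rate_sum
  rw [Finset.sum_add_distrib] at h7
  rw [h1, h3]
  have h8 : (∑ i, N.lam i + ∑ i, N.mu i) * S = S := by rw [h7, one_mul]
  rw [add_mul] at h8
  linarith

/-! ### Hitting values as minimal solutions of the first-step equation. -/

/-- The transition operator of the chain killed at the empty state. -/
noncomputable def killedStep (N : JacksonNetwork d) (f : State d → ℝ≥0∞) (y : State d) : ℝ≥0∞ :=
  ∑ w, N.movePMF w * kill f (step y w)

theorem sum_movePMF (N : JacksonNetwork d) : ∑ w, N.movePMF w = 1 := by
  rw [← N.movePMF.tsum_coe, tsum_fintype]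

theorem killedStep_le_of_forall (N : JacksonNetwork d) {f g : State d → ℝ≥0∞} {y : State d}
    (h : ∀ w, kill f (step y w) ≤ kill g (step y w)) : N.killedStep f y ≤ N.killedStep g y :=
  Finset.sum_le_sum fun w _ => mul_le_mul_right (h w) _

theorem kill_le_kill {f g : State d → ℝ≥0∞} {y : State d} (h : f y ≤ g y) :
    kill f y ≤ kill g y := by
  unfold kill; split_ifs
  · exact le_rfl
  · exact h

theorem killedStep_mono (N : JacksonNetwork d) {f g : State d → ℝ≥0∞} (h : ∀ y, f y ≤ g y)
    (y : State d) : N.killedStep f y ≤ N.killedStep g y :=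
  N.killedStep_le_of_forall fun _ => kill_le_kill (h _)

theorem kill_mul (f : State d → ℝ≥0∞) (c : ℝ≥0∞) (y : State d) :
    kill (fun y => f y * c) y = kill f y * c := by
  unfold kill; split_ifs <;> simp

theorem killedStep_mul (N : JacksonNetwork d) (f : State d → ℝ≥0∞) (c : ℝ≥0∞) (y : State d) :
    N.killedStep (fun y => f y * c) y = N.killedStep f y * c := by
  simp only [killedStep, kill_mul, Finset.sum_mul, mul_assoc]

theorem killedStep_le_one (N : JacksonNetwork d) {f : State d → ℝ≥0∞} (h : ∀ y, f y ≤ 1)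
    (y : State d) : N.killedStep f y ≤ 1 := by
  rw [← N.sum_movePMF]
  refine Finset.sum_le_sum fun w _ => mul_le_of_le_one_right' ?_
  unfold kill
  split_ifs
  · exact zero_le_one
  · exact h _

theorem killedStep_ofReal (N : JacksonNetwork d) {f : State d → ℝ} (hf : ∀ y, 0 ≤ f y)
    (y : State d) : N.killedStep (fun y => ENNReal.ofReal (f y)) y =
      ENNReal.ofReal (N.avg (kill f) y) := by
  rw [N.ofReal_avg (kill_nonneg hf), killedStep]
  refine Finset.sum_congr rfl fun w _ => ?_
  unfold kill
  split_ifs <;> simp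

theorem killedStep_iSup (N : JacksonNetwork d) {f : ℕ → State d → ℝ≥0∞} (hf : Monotone f)
    (y : State d) : N.killedStep (fun y => ⨆ n, f n y) y = ⨆ n, N.killedStep (f n) y := by
  unfold killedStep
  have hmono : ∀ w, Monotone fun n => N.movePMF w * kill (f n) (step y w) :=
    fun w m n hmn => mul_le_mul_right (kill_le_kill (hf hmn _)) _
  rw [← ENNReal.finsetSum_iSup_of_monotone hmono]
  refine Finset.sum_congr rfl fun w _ => ?_
  rw [← ENNReal.mul_iSup]
  unfold kill
  split_ifs <;> simp

/-- The mean of `f` at the point of entrance into `C` for the chain killed at the empty state, with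
the time horizon `n`. -/
noncomputable def hitIter (N : JacksonNetwork d) (C : Set (State d)) (f : State d → ℝ≥0∞) :
    ℕ → State d → ℝ≥0∞
  | 0 => fun _ => 0
  | n + 1 => fun z => open Classical in if z ∈ C then f z else N.killedStep (N.hitIter C f n) z

/-- The mean of `f` at the point of entrance into `C` for the chain killed at the empty state. -/
noncomputable def hitValue (N : JacksonNetwork d) (C : Set (State d)) (f : State d → ℝ≥0∞)
    (z : State d) : ℝ≥0∞ := ⨆ n, N.hitIter C f n z

section

variable (N : JacksonNetwork d) (C : Set (State d)) (f : State d → ℝ≥0∞)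

theorem hitIter_succ_of_mem {z : State d} (hz : z ∈ C) (n : ℕ) :
    N.hitIter C f (n + 1) z = f z := if_pos hz

theorem hitIter_succ_of_notMem {z : State d} (hz : z ∉ C) (n : ℕ) :
    N.hitIter C f (n + 1) z = N.killedStep (N.hitIter C f n) z := if_neg hz

theorem hitIter_monotone : Monotone (N.hitIter C f) := by
  refine monotone_nat_of_le_succ fun n => ?_
  induction n with
  | zero => intro z; exact bot_le
  | succ n ih =>
    intro z
    by_cases hz : z ∈ C
    · rw [hitIter_succ_of_mem _ _ _ hz, hitIter_succ_of_mem _ _ _ hz]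
    · rw [hitIter_succ_of_notMem _ _ _ hz, hitIter_succ_of_notMem _ _ _ hz]
      exact N.killedStep_mono ih z

theorem hitValue_eq_iSup_succ (z : State d) :
    N.hitValue C f z = ⨆ n, N.hitIter C f (n + 1) z :=
  (Monotone.iSup_nat_add (f := fun n => N.hitIter C f n z)
    (fun _ _ h => N.hitIter_monotone C f h z) 1).symm

theorem hitValue_of_mem {z : State d} (hz : z ∈ C) : N.hitValue C f z = f z := by
  simp only [hitValue_eq_iSup_succ, hitIter_succ_of_mem _ _ _ hz, ciSup_const]

theorem hitValue_of_notMem {z : State d} (hz : z ∉ C) :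
    N.hitValue C f z = N.killedStep (N.hitValue C f) z := by
  simp only [hitValue_eq_iSup_succ, hitIter_succ_of_notMem _ _ _ hz]
  exact (N.killedStep_iSup (N.hitIter_monotone C f) z).symm

variable {N C f}

/-- A superharmonic function that dominates `f` at the points of entrance dominates the
hitting value. -/
theorem hitValue_le_of_entrance {g : State d → ℝ≥0∞} (hg : ∀ z ∉ C, N.killedStep g z ≤ g z)
    (hf : ∀ z ∉ C, ∀ w, step z w ∈ C → f (step z w) ≤ g (step z w)) {z : State d} (hz : z ∉ C) :
    N.hitValue C f z ≤ g z := by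
  refine iSup_le fun n => ?_
  induction n generalizing z with
  | zero => exact bot_le
  | succ n ih =>
    rw [hitIter_succ_of_notMem _ _ _ hz]
    refine (N.killedStep_le_of_forall fun w => kill_le_kill ?_).trans (hg z hz)
    -- Before the entrance the induction hypothesis applies; the comparison of `f` with `g` is used
    -- only at points of `C` reached by a step from outside.
    by_cases hw : step z w ∈ C
    · cases n with
      | zero => exact bot_le
      | succ n => rw [hitIter_succ_of_mem _ _ _ hw]; exact hf z hz w hw
    · exact ih hw

theorem hitValue_le {g : State d → ℝ≥0∞} (hg : ∀ z ∉ C, N.killedStep g z ≤ g z)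
    (hf : ∀ z ∈ C, f z ≤ g z) (z : State d) : N.hitValue C f z ≤ g z := by
  by_cases hz : z ∈ C
  · rw [hitValue_of_mem _ _ _ hz]; exact hf z hz
  · exact hitValue_le_of_entrance hg (fun _ _ _ hw => hf _ hw) hz

end

/-! ### Lower bound for hitting a given state within one excursion from 0. -/

/-- From the empty state, a state `z` is hit before the return to the empty state with
probability of order at least `∏ i, ρ_i ^ z_i`. -/
theorem exists_invariant_mul_le [NeZero d] (N : JacksonNetwork d) (hN : N.IsOpen)
    (hρ : ∀ i, N.rho i < 1) :
    ∃ ε : ℝ, 0 < ε ∧ ∀ p : State d → ℝ≥0∞, (∀ y, p y ≤ 1) → (∀ y, N.killedStep p y ≤ p y) →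
      ∀ z, ε * N.invariant z * (p z).toReal ≤ (p 0).toReal := by
  classical
  obtain ⟨G, ε, hε, hG1, hG⟩ := N.exists_geometric_drift_killed hN hρ
  have hε1 : ε ≤ 1 := by
    have h1 := (N.avg_nonneg (kill_nonneg fun y => zero_le_one.trans (hG1 y)) 0).trans (hG 0)
    have h2 := hG1 0
    by_contra h
    nlinarith
  refine ⟨ε, hε, fun p hp1 hp z => ?_⟩
  by_cases hz : z = 0
  · subst hz
    rw [invariant_zero, mul_one]
    exact mul_le_of_le_one_left ENNReal.toReal_nonneg hε1
  have hG0 : ∀ y, 0 < G y := fun y => zero_lt_one.trans_le (hG1 y)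
  set h := N.hitValue {z} (fun _ => 1) with hh
  have hhz : h z = 1 := hitValue_of_mem _ _ _ rfl
  have hh1 : ∀ y, h y ≤ 1 := fun y => hitValue_le (g := fun _ => 1)
    (fun y _ => N.killedStep_le_one (fun _ => le_rfl) y) (fun _ _ => le_rfl) y
  have hhtop : ∀ y, h y ≠ ⊤ := fun y => ((hh1 y).trans_lt ENNReal.one_lt_top).ne
  have hGsup : ∀ y, N.killedStep (fun y => ENNReal.ofReal (G y / G z)) y ≤
      ENNReal.ofReal ((1 - ε) * (G y / G z)) := by
    intro y
    have h1 : ∀ y, ENNReal.ofReal (G y / G z) = ENNReal.ofReal (G y) * ENNReal.ofReal (G z)⁻¹ :=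
      fun y => by rw [div_eq_mul_inv, ENNReal.ofReal_mul (hG0 y).le]
    simp only [h1]
    rw [killedStep_mul, N.killedStep_ofReal fun y => (hG0 y).le, ← ENNReal.ofReal_mul
      (N.avg_nonneg (kill_nonneg fun y => (hG0 y).le) y)]
    refine ENNReal.ofReal_le_ofReal ?_
    rw [div_eq_mul_inv, ← mul_assoc]
    exact mul_le_mul_of_nonneg_right (hG y) (inv_pos.2 (hG0 z)).le
  -- `G` is a supermartingale along the killed chain, so hitting `z` is no likelier than `G y / G
  -- z`. One more step from `z` gains the factor `1 - ε`, which bounds the return probability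
  -- uniformly in `z`.
  have hhG : ∀ y, h y ≤ ENNReal.ofReal (G y / G z) := by
    refine hitValue_le (fun y _ => (hGsup y).trans (ENNReal.ofReal_le_ofReal ?_)) ?_
    · exact mul_le_of_le_one_left (div_pos (hG0 y) (hG0 z)).le (by linarith)
    · rintro y rfl
      rw [div_self (hG0 y).ne', ENNReal.ofReal_one]
  have hret : (N.killedStep h z).toReal ≤ 1 - ε := by
    have h1 := (N.killedStep_mono hhG z).trans (hGsup z)
    rw [div_self (hG0 z).ne', mul_one] at h1
    exact ENNReal.toReal_le_of_le_ofReal (by linarith) h1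
  -- Killing at 0 makes the mean of `f` after one step equal to `killedStep h`. Hence `f` is
  -- harmonic except at 0 and `z`.
  set f : State d → ℝ := fun y => kill (fun y => (h y).toReal) y with hf
  have hf1 : ∀ y, |f y| ≤ 1 := by
    intro y
    simp only [hf, kill]
    split_ifs
    · simp
    · rw [abs_of_nonneg ENNReal.toReal_nonneg]
      exact ENNReal.toReal_le_of_le_ofReal zero_le_one (by simpa using hh1 y)
  have havg : ∀ y, N.avg f y = (N.killedStep h y).toReal := by
    intro y
    have h1 := N.killedStep_ofReal (f := fun y => (h y).toReal)
      (fun y => ENNReal.toReal_nonneg) y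
    simp only [ENNReal.ofReal_toReal (hhtop _)] at h1
    rw [show h = fun y => h y from rfl, h1, ENNReal.toReal_ofReal (N.avg_nonneg
      (kill_nonneg fun y => ENNReal.toReal_nonneg) y)]
  have hharm : ∀ y, y ≠ z → h y = N.killedStep h y := fun y hy => hitValue_of_notMem _ _ _ hy
  have hbal := N.tsum_invariant_mul_avg hN hρ hf1
  have havg1 : ∀ y, |N.avg f y| ≤ 1 := by
    intro y
    rw [havg, abs_of_nonneg ENNReal.toReal_nonneg]
    exact ENNReal.toReal_le_of_le_ofReal zero_le_one
      (by simpa using N.killedStep_le_one hh1 y)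
  have hsub := (N.summable_invariant_mul hN hρ havg1).tsum_sub
    (N.summable_invariant_mul hN hρ hf1)
  rw [hbal, sub_self, tsum_eq_sum (s := {0, z})] at hsub
  · rw [Finset.sum_pair (Ne.symm hz), havg, havg, ← hharm 0 (Ne.symm hz)] at hsub
    have hf0 : f 0 = 0 := kill_zero _
    have hfz : f z = 1 := by simp only [hf, kill_of_ne _ hz, hhz, ENNReal.toReal_one]
    rw [hf0, hfz, invariant_zero] at hsub
    -- The two surviving terms are h(0) at the empty state and `invariant z` times (return
    -- probability - 1) at `z`.
    have h0 : ε * N.invariant z ≤ (h 0).toReal := by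
      nlinarith [N.invariant_pos hN z]
    rcases eq_or_ne (p z) 0 with hpz | hpz
    · simp [hpz]
    have hpt : p z ≠ ⊤ := ((hp1 z).trans_lt ENNReal.one_lt_top).ne
    -- By superharmonicity of `p`, an excursion through `z` gives p(0) ≥ h(0) p(z).
    have hcomp : h 0 ≤ p 0 * (p z)⁻¹ := by
      refine hitValue_le (g := fun y => p y * (p z)⁻¹) (fun y _ => ?_) ?_ 0
      · rw [killedStep_mul]
        exact mul_le_mul_left (hp y) _
      · rintro y rfl
        rw [ENNReal.mul_inv_cancel hpz hpt]
    rw [← div_eq_mul_inv, ENNReal.le_div_iff_mul_le (Or.inl hpz) (Or.inl hpt)] at hcomp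
    have h2 := ENNReal.toReal_mono ((hp1 0).trans_lt ENNReal.one_lt_top).ne hcomp
    rw [ENNReal.toReal_mul] at h2
    exact (mul_le_mul_of_nonneg_right h0 ENNReal.toReal_nonneg).trans h2
  · intro y hy
    simp only [Finset.mem_insert, Finset.mem_singleton, not_or] at hy
    rw [havg, ← hharm y hy.2]
    simp only [hf, kill_of_ne _ hy.1, sub_self]

/-! ### Independence and relabelling of coordinates in a product measure. -/

section Coordinates

open MeasureTheory ProbabilityTheory

variable {ι κ X : Type*} [mX : MeasurableSpace X]

/-- The σ-algebra of the events that depend on the coordinates in `S` only. -/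
abbrev coordAlgebra (X : Type*) [mX : MeasurableSpace X] (S : Set ι) : MeasurableSpace (ι → X) :=
  ⨆ i ∈ S, MeasurableSpace.comap (fun ω => ω i) mX

theorem coordAlgebra_mono {S T : Set ι} (h : S ⊆ T) : coordAlgebra X S ≤ coordAlgebra X T :=
  biSup_mono h

theorem coordAlgebra_le (S : Set ι) : coordAlgebra X S ≤ MeasurableSpace.pi :=
  iSup₂_le fun i _ => (measurable_pi_apply i).comap_le

theorem measurable_coordAlgebra_comp {S : Set ι} {β : Type*} [MeasurableSpace β]
    {f : (κ → X) → β} (hf : Measurable f) (e : κ → ι) (he : ∀ k, e k ∈ S) :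
    Measurable[coordAlgebra X S] fun ω : ι → X => f fun k => ω (e k) := by
  let := coordAlgebra X S
  have h : Measurable fun (ω : ι → X) (k : κ) => ω (e k) := by
    refine measurable_pi_iff.2 fun k => ?_
    exact measurable_iff_comap_le.2 (le_iSup₂_of_le (f := fun (i : ι) (_ : i ∈ S) =>
      MeasurableSpace.comap (fun ω : ι → X => ω i) mX) (e k) (he k) le_rfl)
  exact hf.comp h

variable (μ : Measure X) [IsProbabilityMeasure μ]

theorem lintegral_mul_of_disjoint {S T : Set ι} (hST : Disjoint S T) {f g : (ι → X) → ℝ≥0∞}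
    (hf : Measurable[coordAlgebra X S] f) (hg : Measurable[coordAlgebra X T] g) :
    ∫⁻ ω, f ω * g ω ∂Measure.infinitePi (fun _ : ι => μ) =
      (∫⁻ ω, f ω ∂Measure.infinitePi fun _ : ι => μ) *
        ∫⁻ ω, g ω ∂Measure.infinitePi fun _ : ι => μ := by
  refine lintegral_mul_eq_lintegral_mul_lintegral_of_independent_measurableSpace
    (coordAlgebra_le S) (coordAlgebra_le T) ?_ hf hg
  refine indep_iSup_of_disjoint (fun i => (measurable_pi_apply i).comap_le) ?_ hST
  exact iIndepFun_infinitePi (P := fun _ : ι => μ) (X := fun _ x => x) fun _ => measurable_id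

/-- Cylinders pull back to cylinders with the same factors. This identifies the law of a shifted
event sequence, and of the events of one particle in the tree, with the i.i.d. law. -/
theorem map_comp_infinitePi (e : κ → ι) (he : Function.Injective e) :
    (Measure.infinitePi fun _ : ι => μ).map (fun ω k => ω (e k)) =
      Measure.infinitePi fun _ : κ => μ := by
  classical
  have hmeas : Measurable fun (ω : ι → X) (k : κ) => ω (e k) :=
    measurable_pi_iff.2 fun k => measurable_pi_apply (e k)
  refine Measure.eq_infinitePi _ fun s t ht => ?_
  rw [Measure.map_apply hmeas (MeasurableSet.pi s.countable_toSet fun i _ => ht i)]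
  -- `Function.invFun` needs a nonempty index type.
  rcases isEmpty_or_nonempty κ with hκ | hκ
  · have hs : s = ∅ := Finset.eq_empty_of_isEmpty s
    subst hs
    simp
  have h : (fun (ω : ι → X) (k : κ) => ω (e k)) ⁻¹' ((s : Set κ).pi t) =
      ((s.map ⟨e, he⟩ : Finset ι) : Set ι).pi fun i => t (Function.invFun e i) := by
    ext ω
    simp [Set.mem_pi, Function.leftInverse_invFun he _]
  rw [h, Measure.infinitePi_pi _ fun i _ => ht _, Finset.prod_map]
  simp [Function.leftInverse_invFun he _]

theorem lintegral_comp_infinitePi (e : κ → ι) (he : Function.Injective e)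
    {f : (κ → X) → ℝ≥0∞} (hf : Measurable f) :
    ∫⁻ ω, f (fun k => ω (e k)) ∂Measure.infinitePi (fun _ : ι => μ) =
      ∫⁻ y, f y ∂Measure.infinitePi fun _ : κ => μ := by
  rw [← map_comp_infinitePi μ e he, lintegral_map hf
    (measurable_pi_iff.2 fun k => measurable_pi_apply (e k))]

end Coordinates

/-! ### Hitting values as expectations over trajectories. -/

open MeasureTheory

instance : MeasurableSingletonClass (Move d) where
  measurableSet_singleton w := by
    rcases w with i | i | ij
    · rw [← Set.image_singleton]
      exact (measurableSet_singleton i).inl_image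
    · rw [← Set.image_singleton, ← Set.image_singleton]
      exact (measurableSet_singleton i).inl_image.inr_image
    · rw [← Set.image_singleton, ← Set.image_singleton]
      exact (measurableSet_singleton ij).inr_image.inr_image

theorem path_succ' (z : State d) (y : ℕ → Move d) (t : ℕ) :
    path z y (t + 1) = path (step z (y 0)) (fun s => y (s + 1)) t := by
  induction t with
  | zero => rfl
  | succ t ih => rw [path, ih, path]

/-- The value of `f` at the point of entrance into `C`, if `C` is entered before `0` is hit. -/
noncomputable def hit (C : Set (State d)) (f : State d → ℝ≥0∞) (z : State d)
    (y : ℕ → Move d) : ℝ≥0∞ :=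
  open Classical in
  if Reaches C (path z y) then f (path z y (sInf {t | path z y t ∈ C})) else 0

section Hit

variable {C : Set (State d)} {f : State d → ℝ≥0∞} {z : State d} {y : ℕ → Move d}

theorem reaches_of_mem (hz : z ∈ C) : Reaches C (path z y) :=
  ⟨0, hz, fun s h1 h0 => absurd (h1.trans h0) (by norm_num)⟩

theorem hit_of_mem (hz : z ∈ C) : hit C f z y = f z := by
  rw [hit, if_pos (reaches_of_mem hz)]
  have h : sInf {t | path z y t ∈ C} = 0 := Nat.sInf_eq_zero.2 (Or.inl hz)
  rw [h]; rfl

theorem reaches_iff_of_notMem (hz : z ∉ C) : Reaches C (path z y) ↔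
    step z (y 0) ≠ 0 ∧ Reaches C (path (step z (y 0)) fun t => y (t + 1)) := by
  constructor
  · rintro ⟨t, ht, h⟩
    cases t with
    | zero => exact absurd ht hz
    | succ t =>
      refine ⟨h 1 le_rfl (by omega), t, by rwa [← path_succ'], fun s h1 h2 => ?_⟩
      rw [← path_succ']
      exact h (s + 1) (by omega) (by omega)
  · rintro ⟨h0, t, ht, h⟩
    refine ⟨t + 1, by rwa [path_succ'], fun s h1 h2 => ?_⟩
    obtain ⟨s, rfl⟩ := Nat.exists_eq_add_of_le' h1
    rw [path_succ']
    rcases Nat.eq_zero_or_pos s with rfl | hs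
    · exact h0
    · exact h s hs (by omega)

theorem hit_of_notMem (hz : z ∉ C) : hit C f z y =
    kill (fun s => hit C f s fun t => y (t + 1)) (step z (y 0)) := by
  by_cases h : Reaches C (path z y)
  · obtain ⟨h0, h1⟩ := (reaches_iff_of_notMem hz).1 h
    rw [kill_of_ne _ h0, hit, hit, if_pos h, if_pos h1]
    congr 1
    obtain ⟨t, ht, -⟩ := h
    have hne : {t | path z y t ∈ C}.Nonempty := ⟨t, ht⟩
    -- A positive entrance time is one more than the entrance time of the shifted trajectory.
    have hpos : 0 < sInf {t | path z y t ∈ C} := by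
      rw [Nat.pos_iff_ne_zero]
      intro h
      have := Nat.sInf_mem hne
      rw [h] at this
      exact hz this
    rw [← Nat.sInf_add (n := 1) (p := fun t => path z y t ∈ C) hpos, path_succ']
    simp only [path_succ']
  · unfold kill
    split_ifs with h0
    · exact if_neg h
    · exact (if_neg h).trans (if_neg fun h1 => h ((reaches_iff_of_notMem hz).2 ⟨h0, h1⟩)).symm

end Hit

/-- The restriction of `hit` to the time horizon `n`. -/
noncomputable def pathIter (C : Set (State d)) (f : State d → ℝ≥0∞) :
    ℕ → State d → (ℕ → Move d) → ℝ≥0∞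
  | 0 => fun _ _ => 0
  | n + 1 => fun z y => open Classical in
    if z ∈ C then f z else kill (fun s => pathIter C f n s fun t => y (t + 1)) (step z (y 0))

section PathIter

variable (C : Set (State d)) (f : State d → ℝ≥0∞)

theorem pathIter_succ_of_mem {z : State d} (hz : z ∈ C) (n : ℕ) (y : ℕ → Move d) :
    pathIter C f (n + 1) z y = f z := if_pos hz

theorem pathIter_succ_of_notMem {z : State d} (hz : z ∉ C) (n : ℕ) (y : ℕ → Move d) :
    pathIter C f (n + 1) z y =
      kill (fun s => pathIter C f n s fun t => y (t + 1)) (step z (y 0)) := if_neg hz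

theorem pathIter_monotone (z : State d) (y : ℕ → Move d) :
    Monotone fun n => pathIter C f n z y := by
  refine monotone_nat_of_le_succ fun n => ?_
  induction n generalizing z y with
  | zero => exact bot_le
  | succ n ih =>
    by_cases hz : z ∈ C
    · rw [pathIter_succ_of_mem C f hz, pathIter_succ_of_mem C f hz]
    · rw [pathIter_succ_of_notMem C f hz, pathIter_succ_of_notMem C f hz]
      exact kill_le_kill (ih _ _)

theorem pathIter_le_hit (n : ℕ) (z : State d) (y : ℕ → Move d) :
    pathIter C f n z y ≤ hit C f z y := by
  induction n generalizing z y with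
  | zero => exact bot_le
  | succ n ih =>
    by_cases hz : z ∈ C
    · rw [hit_of_mem hz, pathIter_succ_of_mem C f hz]
    · rw [hit_of_notMem hz, pathIter_succ_of_notMem C f hz]
      exact kill_le_kill (ih _ _)

/-- A trajectory that enters `C` does so at a finite time, so some finite horizon already sees the
whole value; otherwise both sides vanish. -/
theorem exists_pathIter_eq_hit (z : State d) (y : ℕ → Move d) :
    ∃ n, hit C f z y = pathIter C f n z y := by
  by_cases h : Reaches C (path z y)
  · obtain ⟨t, ht, h⟩ := h
    refine ⟨t + 1, ?_⟩
    induction t generalizing z y with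
    | zero =>
      have hz : z ∈ C := ht
      rw [pathIter_succ_of_mem C f hz, hit_of_mem hz]
    | succ t ih =>
      by_cases hz : z ∈ C
      · rw [hit_of_mem hz, pathIter_succ_of_mem C f hz]
      · rw [hit_of_notMem hz, pathIter_succ_of_notMem C f hz]
        have h0 : step z (y 0) ≠ 0 := h 1 le_rfl (by omega)
        rw [kill_of_ne _ h0, kill_of_ne _ h0]
        refine ih _ _ (by rwa [← path_succ']) fun s h1 h2 => ?_
        rw [← path_succ']
        exact h (s + 1) (by omega) (by omega)
  · refine ⟨0, ?_⟩
    rw [hit, if_neg h]; rfl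

theorem hit_eq_iSup (z : State d) (y : ℕ → Move d) :
    hit C f z y = ⨆ n, pathIter C f n z y := by
  refine le_antisymm ?_ (iSup_le fun n => pathIter_le_hit C f n z y)
  obtain ⟨n, hn⟩ := exists_pathIter_eq_hit C f z y
  rw [hn]
  exact le_iSup (fun n => pathIter C f n z y) n

/-- The dependence on the first event becomes a finite sum of indicators. Each summand then factors
into a function of coordinate 0 and a function of later coordinates. -/
theorem kill_apply_eq_sum (g : State d → ℝ≥0∞) (z : State d) (w : Move d) :
    kill g (step z w) = ∑ w', (if w = w' then 1 else 0) * kill g (step z w') := by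
  simp

theorem measurable_pathIter (n : ℕ) (z : State d) : Measurable (pathIter C f n z) := by
  induction n generalizing z with
  | zero => exact measurable_const
  | succ n ih =>
    by_cases hz : z ∈ C
    · exact (funext fun y => pathIter_succ_of_mem C f hz n y) ▸ measurable_const
    · rw [funext fun y => (pathIter_succ_of_notMem C f hz n y).trans (kill_apply_eq_sum _ z (y 0))]
      refine Finset.measurable_sum _ fun w _ => Measurable.mul ?_ ?_
      · exact (measurable_of_countable fun w' : Move d => if w' = w then (1 : ℝ≥0∞) else 0).comp
          (measurable_pi_apply 0)
      · unfold kill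
        split_ifs
        · exact measurable_const
        · exact (ih _).comp (measurable_pi_iff.2 fun t => measurable_pi_apply (t + 1))

theorem measurable_hit (z : State d) : Measurable (hit C f z) := by
  have h : hit C f z = fun y => ⨆ n, pathIter C f n z y := funext fun y => hit_eq_iSup C f z y
  rw [h]
  exact Measurable.iSup fun n => measurable_pathIter C f n z

theorem lintegral_pathIter (N : JacksonNetwork d) (n : ℕ) (z : State d) :
    ∫⁻ y, pathIter C f n z y ∂N.seqLaw = N.hitIter C f n z := by
  have : IsProbabilityMeasure N.seqLaw := by unfold seqLaw; infer_instance
  induction n generalizing z with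
  | zero => simp [pathIter, hitIter]
  | succ n ih =>
    by_cases hz : z ∈ C
    · simp [pathIter, hitIter, hz]
    · rw [hitIter_succ_of_notMem _ _ _ hz]
      rw [lintegral_congr fun y =>
        (pathIter_succ_of_notMem C f hz n y).trans (kill_apply_eq_sum _ z (y 0))]
      have hshift : ∀ w, Measurable[coordAlgebra (Move d) {0}ᶜ] fun y : ℕ → Move d =>
          kill (fun s => pathIter C f n s fun t => y (t + 1)) (step z w) := by
        intro w
        unfold kill
        split_ifs
        · exact @measurable_const _ _ _ (coordAlgebra (Move d) {0}ᶜ) _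
        · exact measurable_coordAlgebra_comp (measurable_pathIter C f n _) (fun t => t + 1)
            (by simp)
      have hfst : ∀ w, Measurable[coordAlgebra (Move d) {0}] fun y : ℕ → Move d =>
          if y 0 = w then (1 : ℝ≥0∞) else 0 := fun w =>
        measurable_coordAlgebra_comp (κ := Unit)
          (f := fun y : Unit → Move d => if y () = w then (1 : ℝ≥0∞) else 0)
          ((measurable_of_countable fun w' : Move d => if w' = w then (1 : ℝ≥0∞) else 0).comp
            (measurable_pi_apply ())) (fun _ => 0) (by simp)
      have hmul : ∀ w ∈ Finset.univ, Measurable fun y : ℕ → Move d => (if y 0 = w then 1 else 0) *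
          kill (fun s => pathIter C f n s fun t => y (t + 1)) (step z w) := fun w _ =>
        ((hfst w).mono (coordAlgebra_le _) le_rfl).mul ((hshift w).mono (coordAlgebra_le _) le_rfl)
      rw [lintegral_finsetSum _ hmul, killedStep]
      refine Finset.sum_congr rfl fun w _ => ?_
      unfold seqLaw
      rw [lintegral_mul_of_disjoint _ (disjoint_compl_right) (hfst w) (hshift w)]
      congr 1
      · rw [lintegral_comp_infinitePi (κ := Unit) _ (fun _ => 0) (fun _ _ _ => rfl)
          (f := fun y : Unit → Move d => if y () = w then (1 : ℝ≥0∞) else 0)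
          ((measurable_of_countable fun w' : Move d => if w' = w then (1 : ℝ≥0∞) else 0).comp
            (measurable_pi_apply ()))]
        have hmp := measurePreserving_eval_infinitePi (fun _ : Unit => N.movePMF.toMeasure) ()
        rw [hmp.lintegral_comp (f := fun w' : Move d => if w' = w then (1 : ℝ≥0∞) else 0)
          (measurable_of_countable _), lintegral_fintype]
        simp
      · unfold kill
        split_ifs
        · simp
        · rw [← ih, lintegral_comp_infinitePi _ (fun t => t + 1) (add_left_injective 1)
            (measurable_pathIter C f n _)]
          rfl

theorem lintegral_hit (N : JacksonNetwork d) (z : State d) :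
    ∫⁻ y, hit C f z y ∂N.seqLaw = N.hitValue C f z := by
  simp only [hit_eq_iSup]
  rw [lintegral_iSup (fun n => measurable_pathIter C f n z)
    fun m n h y => pathIter_monotone C f z y h]
  simp only [lintegral_pathIter, hitValue]

/-- Decomposing by the entrance point separates the trajectory from `f`. This matters when `f` is
itself random and independent of the trajectory, as for the offspring of a particle. -/
theorem hit_eq_tsum (z : State d) (y : ℕ → Move d) :
    hit C f z y = ∑' s, hit C (Pi.single s 1) z y * f s := by
  classical
  by_cases h : Reaches C (path z y)
  · simp only [hit, if_pos h]
    rw [tsum_eq_single (path z y (sInf {t | path z y t ∈ C}))]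
    · simp
    · intro s hs
      rw [Pi.single_eq_of_ne hs.symm, zero_mul]
  · simp [hit, if_neg h]

theorem hitValue_eq_tsum (N : JacksonNetwork d) (z : State d) :
    N.hitValue C f z = ∑' s, N.hitValue C (Pi.single s 1) z * f s := by
  rw [← lintegral_hit]
  simp only [hit_eq_tsum C f]
  rw [lintegral_tsum fun s => ((measurable_hit C _ z).mul_const _).aemeasurable]
  refine tsum_congr fun s => ?_
  rw [lintegral_mul_const _ (measurable_hit C _ z), lintegral_hit]

end PathIter

/-- The probability that the chain started at `z` reaches `C` before it hits the empty state is at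
most the overflow probability. -/
theorem hitValue_le_overflowProb (N : JacksonNetwork d) (v : Finset (Fin d)) {n : ℕ}
    {x : State d} (hx : population v x < n) :
    (N.hitValue {z | n ≤ population v z} (fun _ => 1) x).toReal ≤ N.overflowProb v n x := by
  have : IsProbabilityMeasure N.seqLaw := by unfold seqLaw; infer_instance
  set C : Set (State d) := {z | n ≤ population v z} with hC
  -- An inclusion suffices. The larger event also contains the trajectories that meet neither set,
  -- where both times are infinite, and its measurability is not needed.
  have hsub : {y | hit C (fun _ => 1) x y ≠ 0} ⊆
      {y | returnTime C (path x y) ≤ returnTime {0} (path x y)} := by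
    intro y hy
    have h : Reaches C (path x y) := by
      by_contra h
      exact hy (if_neg h)
    obtain ⟨t, ht, h⟩ := h
    -- `Reaches` allows time 0 while `returnTime` starts at 1; they agree because the start lies
    -- outside `C`.
    have ht1 : 1 ≤ t := by
      rcases Nat.eq_zero_or_pos t with rfl | h
      · have : n ≤ population v x := ht
        omega
      · exact h
    have h1 : returnTime C (path x y) ≤ t := sInf_le ⟨t, ht1, ht, rfl⟩
    refine h1.trans (le_sInf ?_)
    rintro _ ⟨k, hk1, hk, rfl⟩
    have : t < k := by
      by_contra hlt
      exact h k hk1 (not_lt.1 hlt) hk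
    exact_mod_cast this.le
  have hmeas : MeasurableSet {y | hit C (fun _ => 1) x y ≠ 0} :=
    (measurable_hit C _ x (measurableSet_singleton 0)).compl
  have h1 : N.hitValue C (fun _ => 1) x ≤ N.seqLaw {y | hit C (fun _ => 1) x y ≠ 0} := by
    rw [← lintegral_hit, ← lintegral_indicator_one hmeas]
    refine lintegral_mono fun y => ?_
    by_cases h : Reaches C (path x y)
    · have : hit C (fun _ => 1) x y = 1 := if_pos h
      rw [Set.indicator_of_mem (by simp [this])]
      exact this.le
    · rw [hit, if_neg h]
      exact bot_le
  exact ENNReal.toReal_mono (measure_ne_top _ _) (h1.trans (measure_mono hsub))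

/-! ### Moments of the branching particle system. -/

section Tree

variable {r : ℕ} (C : ℕ → Set (State d))

/-- The number of survivors as an extended nonnegative real. -/
noncomputable def count (r : ℕ) (C : ℕ → Set (State d)) (k : ℕ) (σ : List (Fin r)) (z : State d)
    (ω : List (Fin r) × ℕ → Move d) : ℝ≥0∞ := (survivors r C ω k σ z : ℝ≥0∞)

theorem count_zero (σ : List (Fin r)) (z : State d) (ω : List (Fin r) × ℕ → Move d) :
    count r C 0 σ z ω = 1 := by simp [count, survivors]

theorem count_succ (k : ℕ) (σ : List (Fin r)) (z : State d) (ω : List (Fin r) × ℕ → Move d) :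
    count r C (k + 1) σ z ω =
      hit (C k) (fun s => ∑ i : Fin r, count r C k (i :: σ) s ω) z fun t => ω (σ, t) := by
  simp only [count, survivors, hit]
  split_ifs <;> simp

theorem count_succ_sq (k : ℕ) (σ : List (Fin r)) (z : State d)
    (ω : List (Fin r) × ℕ → Move d) : count r C (k + 1) σ z ω ^ 2 =
      hit (C k) (fun s => (∑ i : Fin r, count r C k (i :: σ) s ω) ^ 2) z fun t => ω (σ, t) := by
  rw [count_succ]
  unfold hit
  split_ifs <;> simp

/-- The coordinates of the particles that descend from `σ`. -/
def descendants (σ : List (Fin r)) : Set (List (Fin r) × ℕ) := {a | σ <:+ a.1}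

/-- The coordinates of the particles that descend from `σ`, other than `σ`. -/
def properDescendants (σ : List (Fin r)) : Set (List (Fin r) × ℕ) :=
  {a | σ <:+ a.1 ∧ a.1 ≠ σ}

theorem descendants_cons_subset (i : Fin r) (σ : List (Fin r)) :
    descendants (i :: σ) ⊆ properDescendants σ := by
  rintro ⟨τ, t⟩ h
  have h : i :: σ <:+ τ := h
  refine ⟨(List.suffix_cons i σ).trans h, ?_⟩
  rintro rfl
  have := h.length_le
  simp at this

theorem disjoint_descendants_cons {i j : Fin r} (hij : i ≠ j) (σ : List (Fin r)) :
    Disjoint (descendants (i :: σ)) (descendants (j :: σ)) := by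
  rw [Set.disjoint_left]
  rintro ⟨τ, t⟩ h1 h2
  have h1 : i :: σ <:+ τ := h1
  have h2 : j :: σ <:+ τ := h2
  have h3 := (List.suffix_of_suffix_length_le h1 h2 (by simp)).eq_of_length (by simp)
  exact hij (List.cons.inj h3).1

theorem measurable_hit_coord (D : Set (State d)) (f : State d → ℝ≥0∞) (z : State d)
    (σ : List (Fin r)) {S : Set (List (Fin r) × ℕ)} (hS : ∀ t, (σ, t) ∈ S) :
    Measurable[coordAlgebra (Move d) S] fun ω : List (Fin r) × ℕ → Move d =>
      hit D f z fun t => ω (σ, t) :=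
  measurable_coordAlgebra_comp (measurable_hit D f z) (fun t => (σ, t)) hS

theorem measurable_count (k : ℕ) (σ : List (Fin r)) (z : State d) :
    Measurable[coordAlgebra (Move d) (descendants σ)] (count r C k σ z) := by
  induction k generalizing σ z with
  | zero =>
    rw [funext fun ω => count_zero C σ z ω]
    exact @measurable_const _ _ _ (coordAlgebra (Move d) (descendants σ)) _
  | succ k ih =>
    rw [funext fun ω => (count_succ C k σ z ω).trans (hit_eq_tsum _ _ _ _)]
    let := coordAlgebra (Move d) (descendants σ)
    refine Measurable.tsum fun s => Measurable.mul ?_ ?_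
    · exact measurable_hit_coord _ _ z σ fun t => List.suffix_rfl
    · refine Finset.measurable_sum _ fun i _ => (ih (i :: σ) s).mono (coordAlgebra_mono ?_) le_rfl
      exact (descendants_cons_subset i σ).trans fun a ha => ha.1

/-- The events of a particle and those of its proper descendants occupy disjoint coordinates. At
each entrance point the offspring functional can therefore be replaced by its mean. -/
theorem lintegral_hit_of_independent (N : JacksonNetwork d) (D : Set (State d))
    (Y : State d → (List (Fin r) × ℕ → Move d) → ℝ≥0∞) (σ : List (Fin r)) (z : State d)
    (hY : ∀ s, Measurable[coordAlgebra (Move d) (properDescendants σ)] (Y s)) :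
    ∫⁻ ω, hit D (fun s => Y s ω) z (fun t => ω (σ, t)) ∂N.treeLaw r =
      N.hitValue D (fun s => ∫⁻ ω, Y s ω ∂N.treeLaw r) z := by
  have hS : ∀ t, (σ, t) ∈ {a : List (Fin r) × ℕ | a.1 = σ} := fun t => rfl
  have hdisj : Disjoint {a : List (Fin r) × ℕ | a.1 = σ} (properDescendants σ) := by
    rw [Set.disjoint_left]
    exact fun a h1 h2 => h2.2 h1
  simp only [hit_eq_tsum D fun s => Y s _]
  rw [hitValue_eq_tsum, lintegral_tsum fun s => ?_]
  · refine tsum_congr fun s => ?_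
    unfold treeLaw
    rw [lintegral_mul_of_disjoint _ hdisj (measurable_hit_coord D _ z σ hS) (hY s),
      lintegral_comp_infinitePi _ (fun t => (σ, t)) (fun a b h => (Prod.mk.inj h).2)
        (measurable_hit D _ z)]
    congr 1
    exact lintegral_hit D _ N z
  · exact (((measurable_hit_coord D _ z σ hS).mono (coordAlgebra_le _) le_rfl).mul
      ((hY s).mono (coordAlgebra_le _) le_rfl)).aemeasurable

theorem measurable_sum_count (k : ℕ) (σ : List (Fin r)) (s : State d) :
    Measurable[coordAlgebra (Move d) (properDescendants σ)]
      fun ω => ∑ i : Fin r, count r C k (i :: σ) s ω := by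
  let := coordAlgebra (Move d) (properDescendants σ)
  exact Finset.measurable_sum _ fun i _ => (measurable_count C k (i :: σ) s).mono
    (coordAlgebra_mono (descendants_cons_subset i σ)) le_rfl

theorem measurable_count' (k : ℕ) (σ : List (Fin r)) (z : State d) :
    Measurable (count r C k σ z) :=
  (measurable_count C k σ z).mono (coordAlgebra_le _) le_rfl

theorem lintegral_count_succ (N : JacksonNetwork d) (k : ℕ) (σ : List (Fin r)) (z : State d) :
    ∫⁻ ω, count r C (k + 1) σ z ω ∂N.treeLaw r =
      N.hitValue (C k) (fun s => ∑ i : Fin r, ∫⁻ ω, count r C k (i :: σ) s ω ∂N.treeLaw r) z := by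
  simp only [count_succ]
  rw [N.lintegral_hit_of_independent (C k) (fun s ω => ∑ i : Fin r, count r C k (i :: σ) s ω) σ z
    (measurable_sum_count C k σ)]
  congr 1
  funext s
  exact lintegral_finsetSum _ fun i _ => measurable_count' C k (i :: σ) s

theorem lintegral_count_succ_sq (N : JacksonNetwork d) (k : ℕ) (σ : List (Fin r))
    (z : State d) : ∫⁻ ω, count r C (k + 1) σ z ω ^ 2 ∂N.treeLaw r =
      N.hitValue (C k)
        (fun s => ∫⁻ ω, (∑ i : Fin r, count r C k (i :: σ) s ω) ^ 2 ∂N.treeLaw r) z := by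
  simp only [count_succ_sq]
  refine N.lintegral_hit_of_independent (C k)
    (fun s ω => (∑ i : Fin r, count r C k (i :: σ) s ω) ^ 2) σ z fun s => ?_
  let := coordAlgebra (Move d) (properDescendants σ)
  exact (measurable_sum_count C k σ s).pow_const 2

/-- The offspring of different siblings are independent. -/
theorem lintegral_sum_count_sq_le (N : JacksonNetwork d) (k : ℕ) (σ : List (Fin r))
    (s : State d) {a b : ℝ≥0∞} (ha : ∀ i : Fin r, ∫⁻ ω, count r C k (i :: σ) s ω ∂N.treeLaw r ≤ a)
    (hb : ∀ i : Fin r, ∫⁻ ω, count r C k (i :: σ) s ω ^ 2 ∂N.treeLaw r ≤ b) :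
    ∫⁻ ω, (∑ i : Fin r, count r C k (i :: σ) s ω) ^ 2 ∂N.treeLaw r ≤ r * b + (r * a) ^ 2 := by
  have hmul : ∀ i j : Fin r, Measurable fun ω =>
      count r C k (i :: σ) s ω * count r C k (j :: σ) s ω := fun i j =>
    (measurable_count' C k (i :: σ) s).mul (measurable_count' C k (j :: σ) s)
  simp only [sq, Finset.sum_mul_sum]
  rw [lintegral_finsetSum _ fun i _ => Finset.measurable_sum _ fun j _ => hmul i j]
  have h : ∀ i : Fin r, ∫⁻ ω, ∑ j : Fin r, count r C k (i :: σ) s ω * count r C k (j :: σ) s ω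
      ∂N.treeLaw r ≤ b + r * (a * a) := by
    intro i
    rw [lintegral_finsetSum _ fun j _ => hmul i j]
    -- The diagonal term also receives `a * a`, which makes the sum uniform at no essential cost.
    calc _ ≤ ∑ j : Fin r, ((if j = i then b else 0) + a * a) := by
          refine Finset.sum_le_sum fun j _ => ?_
          split_ifs with hij
          · subst hij
            refine le_trans ?_ le_self_add
            simpa only [sq] using hb j
          · rw [zero_add]
            unfold treeLaw
            rw [lintegral_mul_of_disjoint _ (disjoint_descendants_cons (Ne.symm hij) σ)
              (measurable_count C k (i :: σ) s) (measurable_count C k (j :: σ) s)]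
            exact mul_le_mul' (ha i) (ha j)
      _ = b + r * (a * a) := by
          rw [Finset.sum_add_distrib]
          simp
  refine (Finset.sum_le_sum fun i _ => h i).trans_eq ?_
  rw [Finset.sum_const, Finset.card_univ, Fintype.card_fin, nsmul_eq_mul]
  ring

/-- The probability of reaching `D` before the empty state. -/
noncomputable def reachProb (N : JacksonNetwork d) (D : Set (State d)) (z : State d) : ℝ≥0∞ :=
  N.hitValue D (fun _ => 1) z

theorem reachProb_of_mem (N : JacksonNetwork d) {D : Set (State d)} {z : State d} (hz : z ∈ D) :
    N.reachProb D z = 1 := hitValue_of_mem _ _ _ hz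

theorem reachProb_le_one (N : JacksonNetwork d) (D : Set (State d)) (z : State d) :
    N.reachProb D z ≤ 1 :=
  hitValue_le (g := fun _ => 1) (fun y _ => N.killedStep_le_one (fun _ => le_rfl) y)
    (fun _ _ => le_rfl) z

theorem killedStep_reachProb_le (N : JacksonNetwork d) (D : Set (State d)) (z : State d) :
    N.killedStep (N.reachProb D) z ≤ N.reachProb D z := by
  by_cases hz : z ∈ D
  · rw [N.reachProb_of_mem hz]
    exact N.killedStep_le_one (N.reachProb_le_one D) z
  · exact (hitValue_of_notMem _ _ _ hz).ge

/-- The probability of reaching `C 0` is superharmonic, so its mean at the next entrance point is no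
larger, and each level brings a factor `r`. Only an upper bound is needed, so nesting of the sets
plays no role. -/
theorem lintegral_count_le (N : JacksonNetwork d) {k : ℕ} {σ : List (Fin r)} {z : State d}
    (hz : z ∈ C k) :
    ∫⁻ ω, count r C k σ z ω ∂N.treeLaw r ≤ r ^ k * N.reachProb (C 0) z := by
  have : IsProbabilityMeasure (N.treeLaw r) := by unfold treeLaw; infer_instance
  induction k generalizing σ z with
  | zero => simp [count_zero, N.reachProb_of_mem hz]
  | succ k ih =>
    rw [lintegral_count_succ, mul_comm]
    refine hitValue_le (g := fun z => N.reachProb (C 0) z * r ^ (k + 1)) (fun s _ => ?_)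
      (fun s hs => ?_) z
    · rw [killedStep_mul]
      exact mul_le_mul_left (N.killedStep_reachProb_le (C 0) s) _
    · refine (Finset.sum_le_sum fun i _ => ih hs).trans_eq ?_
      rw [Finset.sum_const, Finset.card_univ, Fintype.card_fin, nsmul_eq_mul]
      ring

/-- The second moment of the number of survivors, when the expected number of survivors of a
particle that has just entered the next set is bounded. -/
theorem lintegral_count_sq_le_of_notMem (N : JacksonNetwork d) (hr : 1 ≤ r) {D : ℝ≥0∞}
    (hD : ∀ k, ∀ z ∉ C k, ∀ w, step z w ∈ C k → r ^ k * N.reachProb (C 0) (step z w) ≤ D)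
    {k : ℕ} {σ : List (Fin r)} {z : State d} (hz : z ∉ C k) :
    ∫⁻ ω, count r C (k + 1) σ z ω ^ 2 ∂N.treeLaw r ≤
      (1 + (k + 1) * (r * D)) * (r ^ (k + 1) * N.reachProb (C 0) z) := by
  have : IsProbabilityMeasure (N.treeLaw r) := by unfold treeLaw; infer_instance
  set p := N.reachProb (C 0) with hp
  have hr' : (1 : ℝ≥0∞) ≤ r := by exact_mod_cast hr
  -- In r · (second moment) + (r · mean)^2, one factor of the square is at most `r * D`. Each level
  -- thus adds a single `r * D`, and the coefficient grows linearly in `k` rather than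
  -- geometrically.
  have hsum : ∀ k, (∀ (σ : List (Fin r)) (z : State d), z ∈ C k → r ^ k * p z ≤ D →
      ∫⁻ ω, count r C k σ z ω ^ 2 ∂N.treeLaw r ≤ (1 + k * (r * D)) * (r ^ k * p z)) →
      ∀ (σ : List (Fin r)) (s : State d), s ∈ C k → r ^ k * p s ≤ D →
      ∫⁻ ω, (∑ i : Fin r, count r C k (i :: σ) s ω) ^ 2 ∂N.treeLaw r ≤
        (1 + (k + 1) * (r * D)) * (r ^ (k + 1) * p s) := by
    intro k ih σ s hs hsD
    refine (N.lintegral_sum_count_sq_le C k σ s (fun i => N.lintegral_count_le C hs)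
      fun i => ih (i :: σ) s hs hsD).trans ?_
    calc r * ((1 + k * (r * D)) * (r ^ k * p s)) + (r * (r ^ k * p s)) ^ 2
        = (1 + k * (r * D)) * (r ^ (k + 1) * p s) +
            r * (r ^ k * p s) * (r ^ (k + 1) * p s) := by ring
      _ ≤ (1 + k * (r * D)) * (r ^ (k + 1) * p s) + r * D * (r ^ (k + 1) * p s) := by gcongr
      _ = _ := by ring
  have hsuper : ∀ (c : ℝ≥0∞) (m : ℕ) (z : State d),
      N.killedStep (fun z => c * (r ^ m * p z)) z ≤ c * (r ^ m * p z) := by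
    intro c m z
    have h : ∀ z, c * (r ^ m * p z) = p z * (c * r ^ m) := fun z => by ring
    simp only [h]
    rw [killedStep_mul]
    exact mul_le_mul_left (N.killedStep_reachProb_le (C 0) z) _
  have key : ∀ (k : ℕ) (σ : List (Fin r)) (z : State d), z ∈ C k → r ^ k * p z ≤ D →
      ∫⁻ ω, count r C k σ z ω ^ 2 ∂N.treeLaw r ≤ (1 + k * (r * D)) * (r ^ k * p z) := by
    intro k
    induction k with
    | zero =>
      intro σ z hz _
      simp [count_zero, hp, N.reachProb_of_mem hz]
    | succ k ih =>
      intro σ z _ hzD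
      rw [lintegral_count_succ_sq]
      push_cast
      -- A particle already inside the next set splits on the spot and inherits the bound by `D`
      -- from its present level; otherwise it steps in from outside, where `hD` applies.
      by_cases hz : z ∈ C k
      · rw [hitValue_of_mem _ _ _ hz]
        refine hsum k ih σ z hz (le_trans ?_ hzD)
        gcongr
        exact Nat.le_succ k
      · exact hitValue_le_of_entrance (g := fun z => (1 + (k + 1) * (r * D)) * (r ^ (k + 1) * p z))
          (fun s _ => hsuper _ _ s) (fun s hs w hw => hsum k ih σ _ hw (hD k s hs w hw)) hz
  rw [lintegral_count_succ_sq]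
  exact hitValue_le_of_entrance (g := fun z => (1 + (k + 1) * (r * D)) * (r ^ (k + 1) * p z))
    (fun s _ => hsuper _ _ s)
    (fun s hs w hw => hsum k (key k) σ _ hw (hD k s hs w hw)) hz

theorem survivors_le (ω : List (Fin r) × ℕ → Move d) (k : ℕ) (σ : List (Fin r)) (z : State d) :
    survivors r C ω k σ z ≤ r ^ k := by
  induction k generalizing σ z with
  | zero => simp [survivors]
  | succ k ih =>
    rw [survivors]
    split_ifs
    · refine (Finset.sum_le_sum fun i _ => ih _ _).trans_eq ?_
      simp [pow_succ']
    · exact Nat.zero_le _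

end Tree

/-! ### Monotonicity in the state and the geometry of the level sets. -/

theorem step_mono {x y : State d} (h : x ≤ y) (w : Move d) : step x w ≤ step y w := by
  have hle : ∀ k, x k ≤ y k := h
  rcases w with i | i | ⟨i, j⟩ <;> intro k <;> have hk := hle k <;> have hi := hle i
  · exact Nat.add_le_add_right hk _
  · simp only [step]
    rcases eq_or_ne k i with rfl | hki
    · split_ifs <;> (try simp only [Pi.sub_apply, Pi.single_eq_same]) <;> omega
    · split_ifs <;> (try simp only [Pi.sub_apply, Pi.single_eq_of_ne hki]) <;> omega
  · simp only [step]
    rcases eq_or_ne k i with rfl | hki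
    · split_ifs <;> (try simp only [Pi.add_apply, Pi.sub_apply, Pi.single_eq_same]) <;> omega
    · split_ifs <;> (try simp only [Pi.add_apply, Pi.sub_apply, Pi.single_eq_of_ne hki]) <;> omega

theorem population_mono (v : Finset (Fin d)) {x y : State d} (h : x ≤ y) :
    population v x ≤ population v y := Finset.sum_le_sum fun i _ => h i

/-- Under common events the coordinatewise order is preserved. The larger path is then in the upper
set whenever the smaller one is, and it is empty only if the smaller one is. -/
theorem reachProb_mono (N : JacksonNetwork d) {D : Set (State d)} (hD : IsUpperSet D)
    {x y : State d} (h : x ≤ y) : N.reachProb D x ≤ N.reachProb D y := by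
  refine iSup_mono fun n => ?_
  induction n generalizing x y with
  | zero => exact le_rfl
  | succ n ih =>
    by_cases hy : y ∈ D
    · rw [hitIter_succ_of_mem _ _ _ hy]
      refine (le_iSup (fun n => N.hitIter D (fun _ => 1) n x) (n + 1)).trans ?_
      exact N.reachProb_le_one D x
    · have hx : x ∉ D := fun hx => hy (hD h hx)
      rw [hitIter_succ_of_notMem _ _ _ hx, hitIter_succ_of_notMem _ _ _ hy]
      refine Finset.sum_le_sum fun w _ => mul_le_mul_right ?_ _
      have hw := step_mono h w
      unfold kill
      split_ifs with h1 h2 h2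
      · exact le_rfl
      · exact bot_le
      · exact absurd (le_antisymm (hw.trans_eq h2) bot_le) h1
      · exact ih hw

/-- One transition lowers the invariant measure by a bounded factor. -/
theorem mul_invariant_le_invariant_step (N : JacksonNetwork d) (hN : N.IsOpen)
    (hρ : ∀ i, N.rho i < 1) {c : ℝ} (hc1 : c ≤ 1) (hc : ∀ i, c ≤ N.rho i) (z : State d)
    (w : Move d) : c * N.invariant z ≤ N.invariant (step z w) := by
  have hpos := N.invariant_pos hN
  have hsub : ∀ i, z i ≠ 0 → N.invariant z ≤ N.invariant (z - Pi.single i 1) := by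
    intro i hi
    conv_lhs => rw [exists_eq_add_single hi, invariant_add_single]
    exact mul_le_of_le_one_left (hpos _).le (hρ i).le
  have hself : c * N.invariant z ≤ N.invariant z := mul_le_of_le_one_left (hpos z).le hc1
  rcases w with i | i | ⟨i, j⟩
  · simp only [step, invariant_add_single]
    exact mul_le_mul_of_nonneg_right (hc i) (hpos z).le
  · simp only [step]
    split_ifs with h
    · exact hself
    · exact hself.trans (hsub i h)
  · simp only [step]
    split_ifs with h
    · exact hself
    · rw [invariant_add_single]
      exact mul_le_mul (hc j) (hsub i h) (hpos z).le (N.rho_pos hN j).le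

theorem invariant_le_one (N : JacksonNetwork d) (hN : N.IsOpen) (hρ : ∀ i, N.rho i < 1)
    (z : State d) : N.invariant z ≤ 1 :=
  Finset.prod_le_one (fun i _ => pow_nonneg (N.rho_pos hN i).le _)
    fun i _ => pow_le_one₀ (N.rho_pos hN i).le (hρ i).le

theorem log_invariant (N : JacksonNetwork d) (hN : N.IsOpen) (z : State d) :
    Real.log (N.invariant z) = ∑ i, Real.log (N.rho i) * z i := by
  rw [invariant, Real.log_prod fun i _ => pow_ne_zero _ (N.rho_pos hN i).ne']
  exact Finset.sum_congr rfl fun i _ => by rw [Real.log_pow, mul_comm]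

theorem exists_rho_eq_rhoMax (N : JacksonNetwork d) (v : Finset (Fin d)) (hv : v.Nonempty) :
    ∃ i ∈ v, N.rho i = N.rhoMax v hv := by
  obtain ⟨i, hi, h⟩ := Finset.exists_mem_eq_sup' hv N.rho
  exact ⟨i, hi, h.symm⟩

/-- Multiplying the importance condition by n (log r) / Δ and exponentiating removes `Δ`. The levels
are geometric shells of the invariant measure, which is what links the splitting to
`exists_invariant_mul_le`. -/
theorem mem_levelSet_iff (N : JacksonNetwork d) (hN : N.IsOpen) (v : Finset (Fin d))
    (hv : v.Nonempty) {r : ℕ} (hr : 1 < r) {Δ : ℝ} (hΔ : 0 < Δ) {n : ℕ} (hn : n ≠ 0) (j : ℕ)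
    (z : State d) : z ∈ N.levelSet v hv r Δ n j ↔ n ≤ population v z ∨
      (1 ≤ j ∧ N.invariant z ≤ r ^ j * N.rhoMax v hv ^ n) := by
  have hmax : 0 < N.rhoMax v hv := by
    obtain ⟨i, -, hi⟩ := N.exists_rho_eq_rhoMax v hv
    exact hi ▸ N.rho_pos hN i
  have hr1 : (1 : ℝ) < r := by exact_mod_cast hr
  have hr0 : (0 : ℝ) < r := zero_lt_one.trans hr1
  have hlog : 0 < Real.log r := Real.log_pos hr1
  have hn0 : (0 : ℝ) < n := by exact_mod_cast Nat.pos_of_ne_zero hn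
  have h : N.importance v hv r Δ (fun i => (z i : ℝ) / n) ≤ j * Δ / n ↔
      N.invariant z ≤ r ^ j * N.rhoMax v hv ^ n := by
    have h1 : N.subsolution v hv (fun i => (z i : ℝ) / n) =
        (Real.log (N.invariant z) - n * Real.log (N.rhoMax v hv)) / n := by
      rw [subsolution, log_invariant N hN, sub_div, mul_div_cancel_left₀ _ hn0.ne', Finset.sum_div]
      simp only [mul_div_assoc]
    rw [importance, h1, ← Real.log_le_log_iff (N.invariant_pos hN z) (by positivity),
      Real.log_mul (by positivity) (by positivity), Real.log_pow, Real.log_pow,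
      mul_div_assoc', div_div, div_le_div_iff₀ (by positivity) hn0]
    have h2 : (j : ℝ) * Δ * (n * Real.log r) = Δ * n * (j * Real.log r) := by ring
    have h3 : Δ * (Real.log (N.invariant z) - n * Real.log (N.rhoMax v hv)) * n =
        Δ * n * (Real.log (N.invariant z) - n * Real.log (N.rhoMax v hv)) := by ring
    rw [h2, h3, mul_le_mul_iff_right₀ (by positivity), sub_le_iff_le_add]
  rw [levelSet, Set.mem_ofPred_eq, h]

theorem levelSet_zero (N : JacksonNetwork d) (v : Finset (Fin d)) (hv : v.Nonempty) (r : ℕ)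
    (Δ : ℝ) (n : ℕ) : N.levelSet v hv r Δ n 0 = {z | n ≤ population v z} := by
  ext z
  simp [levelSet]

/-- The only fact about β that is needed, since the second-moment bound is linear in n. -/
theorem one_le_numBottlenecks [NeZero d] (N : JacksonNetwork d) : 1 ≤ N.numBottlenecks := by
  obtain ⟨i, hi⟩ := Finite.exists_max N.rho
  exact (Set.ncard_pos (Set.toFinite _)).2 ⟨i, hi⟩

/-! ### The second moment of the estimator. -/

theorem estimator_sq (N : JacksonNetwork d) (v : Finset (Fin d)) (hv : v.Nonempty) (r : ℕ)
    (Δ : ℝ) (n : ℕ) (x : State d) (ω : List (Fin r) × ℕ → Move d) :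
    N.estimator v hv r Δ n x ω ^ 2 =
      (count r (N.levelSet v hv r Δ n) (N.level v hv r Δ n x) [] x ω ^ 2).toReal /
        ((r : ℝ) ^ N.level v hv r Δ n x) ^ 2 := by
  rw [estimator, div_pow, count, ENNReal.toReal_pow, ENNReal.toReal_natCast]

theorem integrable_estimator_sq (N : JacksonNetwork d) (v : Finset (Fin d)) (hv : v.Nonempty)
    (r : ℕ) (Δ : ℝ) (n : ℕ) (x : State d) :
    Integrable (fun ω => N.estimator v hv r Δ n x ω ^ 2) (N.treeLaw r) := by
  have : IsProbabilityMeasure (N.treeLaw r) := by unfold treeLaw; infer_instance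
  simp only [estimator_sq]
  refine Integrable.div_const ?_ _
  refine Integrable.of_bound (C := ((r : ℝ) ^ N.level v hv r Δ n x) ^ 2)
    ((measurable_count' _ _ _ _).pow_const 2).ennreal_toReal.aestronglyMeasurable
    (Filter.Eventually.of_forall fun ω => ?_)
  rw [Real.norm_eq_abs, abs_of_nonneg ENNReal.toReal_nonneg, count, ENNReal.toReal_pow,
    ENNReal.toReal_natCast]
  have := survivors_le (N.levelSet v hv r Δ n) ω (N.level v hv r Δ n x) [] x
  gcongr
  exact_mod_cast this

/-- The second moment of the estimator is at most `C (l_n(x) + 1) p²`. -/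
theorem exists_integral_estimator_sq_le [NeZero d] (N : JacksonNetwork d) (hN : N.IsOpen)
    (hρ : ∀ i, N.rho i < 1) (v : Finset (Fin d)) (hv : v.Nonempty) {r : ℕ} (hr : 1 < r) {Δ : ℝ}
    (hΔ : 0 < Δ) (x : State d) :
    ∃ A : ℝ, 0 ≤ A ∧ ∀ n : ℕ, population v x < n → ∃ k : ℕ,
      (r : ℝ) ^ k * N.rhoMax v hv ^ n ≤ 1 ∧
      ∫ ω, N.estimator v hv r Δ n x ω ^ 2 ∂N.treeLaw r ≤
        A * (k + 2) * N.overflowProb v n x ^ 2 := by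
  obtain ⟨ε, hε, hkey⟩ := N.exists_invariant_mul_le hN hρ
  obtain ⟨i₀, hi₀v, hi₀⟩ := N.exists_rho_eq_rhoMax v hv
  obtain ⟨i₁, hi₁⟩ := Finite.exists_min N.rho
  set c := N.rho i₁ with hc
  have hc0 : 0 < c := N.rho_pos hN i₁
  have hc1 : c ≤ 1 := (hρ i₁).le
  have hmax0 : 0 < N.rhoMax v hv := hi₀ ▸ N.rho_pos hN i₀
  have hmax1 : N.rhoMax v hv < 1 := hi₀ ▸ hρ i₀
  have hr0 : (0 : ℝ) < r := by exact_mod_cast zero_lt_one.trans hr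
  have hr1 : (1 : ℝ) ≤ r := by exact_mod_cast hr.le
  have hmx := N.invariant_pos hN x
  refine ⟨r / (ε * c * N.invariant x), by positivity, fun n hn => ?_⟩
  have hn0 : n ≠ 0 := by omega
  set D := {z : State d | n ≤ population v z} with hDdef
  set C := N.levelSet v hv r Δ n with hC
  have hC0 : C 0 = D := N.levelSet_zero v hv r Δ n
  have hmem := N.mem_levelSet_iff hN v hv hr hΔ hn0
  set p : State d → ℝ := fun z => (N.reachProb D z).toReal with hp
  have hptop : ∀ z, N.reachProb D z ≠ ⊤ := fun z =>
    ((N.reachProb_le_one D z).trans_lt ENNReal.one_lt_top).ne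
  have hp0 : ∀ z, 0 ≤ p z := fun z => ENNReal.toReal_nonneg
  have hp1 : ∀ z, p z ≤ 1 := fun z => ENNReal.toReal_le_of_le_ofReal zero_le_one
    (by simpa using N.reachProb_le_one D z)
  have hpz : ∀ z, ε * N.invariant z * p z ≤ p 0 :=
    hkey _ (N.reachProb_le_one D) (N.killedStep_reachProb_le D)
  have hp0x : p 0 ≤ p x := ENNReal.toReal_mono (hptop x)
    (N.reachProb_mono (fun a b hab ha => ha.trans (population_mono v hab)) bot_le)
  -- The target state has all `n` jobs at a station of `v` with maximal intensity; it lies in the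
  -- overflow set, so p = 1 there.
  have hpn : ε * N.rhoMax v hv ^ n ≤ p 0 := by
    have h1 := hpz (Pi.single i₀ n)
    have h2 : N.invariant (Pi.single i₀ n) = N.rhoMax v hv ^ n := by
      rw [invariant, Finset.prod_eq_single i₀]
      · rw [Pi.single_eq_same, hi₀]
      · intro b _ hb
        rw [Pi.single_eq_of_ne hb, pow_zero]
      · simp
    have h3 : Pi.single i₀ n ∈ D := by
      have : (Pi.single i₀ n : State d) i₀ ≤ population v (Pi.single i₀ n) :=
        Finset.single_le_sum (f := fun i => (Pi.single i₀ n : State d) i)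
          (fun _ _ => Nat.zero_le _) hi₀v
      simpa [hDdef] using this
    have h4 : p (Pi.single i₀ n) = 1 := by simp [hp, N.reachProb_of_mem h3]
    rwa [h2, h4, mul_one] at h1
  have hxD : x ∉ D := not_le.2 hn
  obtain ⟨j, hj⟩ : ∃ j, x ∈ C j := by
    have h1 : Filter.Tendsto (fun j : ℕ => (r : ℝ) ^ j) Filter.atTop Filter.atTop :=
      tendsto_pow_atTop_atTop_of_one_lt (by exact_mod_cast hr)
    obtain ⟨j, hj1, hj⟩ := ((Filter.eventually_ge_atTop 1).and
      (h1.eventually_ge_atTop (N.invariant x / N.rhoMax v hv ^ n))).exists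
    refine ⟨j, (hmem j x).2 (Or.inr ⟨hj1, ?_⟩)⟩
    rwa [div_le_iff₀ (by positivity)] at hj
  have hlevel : x ∈ C (N.level v hv r Δ n x) := Nat.sInf_mem (s := {j | x ∈ C j}) ⟨j, hj⟩
  obtain ⟨k, hk⟩ : ∃ k, N.level v hv r Δ n x = k + 1 := by
    refine Nat.exists_eq_succ_of_ne_zero fun h => hxD ?_
    rw [h, hC0] at hlevel
    exact hlevel
  have hxk : x ∉ C k := Nat.notMem_of_lt_sInf (s := {j | x ∈ C j})
    (show k < N.level v hv r Δ n x by omega)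
  rw [hk] at hlevel
  have hlev : N.invariant x ≤ r ^ (k + 1) * N.rhoMax v hv ^ n := by
    rcases (hmem _ x).1 hlevel with h | h
    · exact absurd h hxD
    · exact h.2
  refine ⟨k, ?_, ?_⟩
  -- Since `x` lies outside `C k`, its invariant weight, which is at most 1, exceeds `r ^ k * rhoMax
  -- ^ n` when `k` is positive.
  · rcases Nat.eq_zero_or_pos k with rfl | hkpos
    · simpa using pow_le_one₀ hmax0.le hmax1.le
    · have h : ¬ N.invariant x ≤ r ^ k * N.rhoMax v hv ^ n := fun h =>
        hxk ((hmem k x).2 (Or.inr ⟨hkpos, h⟩))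
      exact (not_le.1 h).le.trans (N.invariant_le_one hN hρ x)
  -- The factor `c`, the smallest intensity, pays for the single step from outside the level set to
  -- the entrance point, where the weight may be lower than outside.
  set B : ℝ := p 0 / (ε * c * N.rhoMax v hv ^ n) with hB
  have hB0 : 0 ≤ B := div_nonneg (hp0 0) (by positivity)
  have hentrance : ∀ j, ∀ z ∉ C j, ∀ w, step z w ∈ C j →
      (r : ℝ≥0∞) ^ j * N.reachProb (C 0) (step z w) ≤ ENNReal.ofReal B := by
    intro j z hz w _
    rw [hC0, ← ENNReal.ofReal_toReal (hptop (step z w)), ← ENNReal.ofReal_natCast,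
      ← ENNReal.ofReal_pow hr0.le, ← ENNReal.ofReal_mul (by positivity)]
    refine ENNReal.ofReal_le_ofReal ?_
    change (r : ℝ) ^ j * p (step z w) ≤ B
    rw [hB, le_div_iff₀ (by positivity)]
    -- For `j = 0` being outside the set gives no lower bound on the weight; p ≤ 1 and `hpn` replace
    -- it.
    rcases Nat.eq_zero_or_pos j with rfl | hj
    · rw [pow_zero, one_mul]
      calc p (step z w) * (ε * c * N.rhoMax v hv ^ n) ≤ 1 * (ε * 1 * N.rhoMax v hv ^ n) := by
            gcongr
            exact hp1 _
        _ ≤ p 0 := by rwa [one_mul, mul_one]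
    · have h : r ^ j * N.rhoMax v hv ^ n ≤ N.invariant z := by
        by_contra h
        exact hz ((hmem j z).2 (Or.inr ⟨hj, (not_le.1 h).le⟩))
      calc (r : ℝ) ^ j * p (step z w) * (ε * c * N.rhoMax v hv ^ n)
          = ε * (c * (r ^ j * N.rhoMax v hv ^ n)) * p (step z w) := by ring
        _ ≤ ε * (c * N.invariant z) * p (step z w) := by
            gcongr
        _ ≤ ε * N.invariant (step z w) * p (step z w) := by
            gcongr
            exact N.mul_invariant_le_invariant_step hN hρ hc1 hi₁ z w
        _ ≤ p 0 := hpz _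
  have hmoment := N.lintegral_count_sq_le_of_notMem C hr.le hentrance (σ := []) hxk
  have hint : ∫ ω, (count r C (k + 1) [] x ω ^ 2).toReal ∂N.treeLaw r ≤
      (1 + (k + 1) * (r * B)) * (r ^ (k + 1) * p x) := by
    rw [integral_toReal ((measurable_count' C _ _ _).pow_const 2).aemeasurable
      (Filter.Eventually.of_forall fun ω => by simp [count])]
    refine ENNReal.toReal_le_of_le_ofReal (by have := hp0 x; positivity) (hmoment.trans_eq ?_)
    rw [hC0, ENNReal.ofReal_mul (by positivity), ENNReal.ofReal_mul (by positivity),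
      ENNReal.ofReal_add (by positivity) (by positivity), ENNReal.ofReal_mul (by positivity),
      ENNReal.ofReal_mul (by positivity), ENNReal.ofReal_pow (by positivity),
      ENNReal.ofReal_add (by positivity) (by positivity), ENNReal.ofReal_natCast,
      ENNReal.ofReal_natCast, ENNReal.ofReal_one, ENNReal.ofReal_toReal (hptop x)]
  have hpover : p x ≤ N.overflowProb v n x := N.hitValue_le_overflowProb v hn
  simp only [estimator_sq, hk]
  rw [integral_div, div_le_iff₀ (by positivity)]
  refine hint.trans ?_
  have hB1 : B * (ε * c * N.rhoMax v hv ^ n) = p 0 := div_mul_cancel₀ _ (by positivity)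
  -- The definition of the initial level gives ρ^x ≤ r^{k+1} ρ_*^n. The factor ρ_*^n is absorbed by
  -- `hpn` in the term 1 and cancels the denominator of `B` in the other term.
  have hmain : N.invariant x * (ε * c) * (1 + (k + 1) * (r * B)) ≤
      r * (k + 2) * p x * r ^ (k + 1) := by
    have h1 : N.invariant x * (ε * c) ≤ p x * r ^ (k + 1) := by
      calc N.invariant x * (ε * c) ≤ r ^ (k + 1) * N.rhoMax v hv ^ n * (ε * 1) := by gcongr
        _ = ε * N.rhoMax v hv ^ n * r ^ (k + 1) := by ring
        _ ≤ p x * r ^ (k + 1) := by gcongr; exact hpn.trans hp0x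
    have h2 : N.invariant x * (ε * c) * B ≤ p x * r ^ (k + 1) := by
      calc N.invariant x * (ε * c) * B ≤ r ^ (k + 1) * N.rhoMax v hv ^ n * (ε * c) * B := by gcongr
        _ = B * (ε * c * N.rhoMax v hv ^ n) * r ^ (k + 1) := by ring
        _ = p 0 * r ^ (k + 1) := by rw [hB1]
        _ ≤ p x * r ^ (k + 1) := by gcongr
    have h3 : 0 ≤ p x * r ^ (k + 1) := mul_nonneg (hp0 x) (by positivity)
    calc N.invariant x * (ε * c) * (1 + (k + 1) * (r * B))
        = N.invariant x * (ε * c) + (k + 1) * r * (N.invariant x * (ε * c) * B) := by ring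
      _ ≤ r * (p x * r ^ (k + 1)) + (k + 1) * r * (p x * r ^ (k + 1)) := by
          exact add_le_add (h1.trans (le_mul_of_one_le_left h3 hr1))
            (mul_le_mul_of_nonneg_left h2 (by positivity))
      _ = _ := by ring
  have hfin : (1 + (k + 1) * (r * B)) ≤
      r / (ε * c * N.invariant x) * (k + 2) * p x * r ^ (k + 1) := by
    rw [div_mul_eq_mul_div, div_mul_eq_mul_div, div_mul_eq_mul_div, le_div_iff₀ (by positivity)]
    linarith
  have hpx := hp0 x
  calc (1 + (k + 1) * (r * B)) * (r ^ (k + 1) * p x)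
      ≤ r / (ε * c * N.invariant x) * (k + 2) * p x * r ^ (k + 1) * (r ^ (k + 1) * p x) := by
        gcongr
    _ = r / (ε * c * N.invariant x) * (k + 2) * p x ^ 2 * (r ^ (k + 1)) ^ 2 := by ring
    _ ≤ _ := by gcongr

end JacksonNetwork

theorem proposition6 {d : ℕ} (N : JacksonNetwork d) (hopen : N.IsOpen) (hstable : N.IsStable)
    (v : Finset (Fin d)) (hv : v.Nonempty) (r : ℕ) (hr : 1 < r)
    (Δ : ℝ) (hΔ0 : 0 < Δ) (hΔ1 : Δ ≤ 1) (x : JacksonNetwork.State d) :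
    (∀ n : ℕ, MeasureTheory.Integrable
      (fun ω => N.estimator v hv r Δ n x ω ^ 2) (N.treeLaw r)) ∧
    Asymptotics.IsBigO Filter.atTop
      (fun n : ℕ => ∫ ω, N.estimator v hv r Δ n x ω ^ 2 ∂(N.treeLaw r))
      (fun n : ℕ => N.overflowProb v n x ^ 2 * (n : ℝ) ^ N.numBottlenecks) := by
  refine ⟨fun n => N.integrable_estimator_sq v hv r Δ n x, ?_⟩
  have hd : NeZero d := ⟨by rintro rfl; exact hv.choose.elim0⟩
  have hρ := N.rho_lt_one hopen hstable
  obtain ⟨A, hA, h⟩ := N.exists_integral_estimator_sq_le hopen hρ v hv hr hΔ0 x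
  obtain ⟨i₀, -, hi₀⟩ := N.exists_rho_eq_rhoMax v hv
  have hmax0 : 0 < N.rhoMax v hv := hi₀ ▸ N.rho_pos hopen i₀
  have hmax1 : N.rhoMax v hv < 1 := hi₀ ▸ hρ i₀
  have hlogr : 0 < Real.log r := Real.log_pos (by exact_mod_cast hr)
  have hr0 : (0 : ℝ) < r := by exact_mod_cast zero_lt_one.trans hr
  -- From r^k ρ_*^n ≤ 1, taking logarithms bounds the number of levels by `n * s`.
  set s := -Real.log (N.rhoMax v hv) / Real.log r with hs
  have hs0 : 0 ≤ s := div_nonneg (neg_nonneg.2 (Real.log_nonpos hmax0.le hmax1.le)) hlogr.le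
  refine Asymptotics.IsBigO.of_bound (A * (s + 2)) ?_
  -- For these `n` the start is outside the overflow set, and `n ≥ 1` allows `k + 2 ≤ (s + 2) * n`.
  filter_upwards [Filter.eventually_gt_atTop (JacksonNetwork.population v x)] with n hn
  obtain ⟨k, hk, hle⟩ := h n hn
  have hn1 : (1 : ℝ) ≤ n := by exact_mod_cast Nat.one_le_of_lt hn
  have hkn : (k : ℝ) ≤ n * s := by
    have h1 := Real.log_nonpos (by positivity) hk
    rw [Real.log_mul (by positivity) (by positivity), Real.log_pow, Real.log_pow] at h1
    rw [hs, mul_div_assoc', le_div_iff₀ hlogr]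
    linarith
  have hpow : (n : ℝ) ≤ n ^ N.numBottlenecks :=
    le_self_pow₀ hn1 (Nat.one_le_iff_ne_zero.1 N.one_le_numBottlenecks)
  rw [Real.norm_of_nonneg (MeasureTheory.integral_nonneg fun ω => sq_nonneg _),
    Real.norm_of_nonneg (by positivity)]
  calc _ ≤ A * (k + 2) * N.overflowProb v n x ^ 2 := hle
    _ ≤ A * ((s + 2) * n) * N.overflowProb v n x ^ 2 := by
        gcongr
        nlinarith
    _ ≤ A * ((s + 2) * n ^ N.numBottlenecks) * N.overflowProb v n x ^ 2 := by gcongr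
    _ = _ := by ring
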